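/- Conventions. Let $d\ge 0$. A $d$-dimensional Markov process $(\Omega,\mathcal F,\{\mathbb P^x\}_{x\in\mathbb R^d},\{\mathcal F_t\}_{t\ge0},\{\theta_t\}_{t\ge0},\{X_t\}_{t\ge0})$ takes values in the one-point compactification $\mathbb R^d\cup\{\infty\}$, where $\infty$ is an absorbing cemetery (killing is allowed); functions on $\mathbb R^d$ are extended by $f(\infty)=0$, and $P_tf(x)=\mathbb E^x[f(X_t)]$ for bounded Borel $f$. The process is Feller if $\{P_t\}_{t\ge0}$ maps $C_\infty(\mathbb R^d)$ (continuous functions vanishing at infinity) into itself and is strongly continuous there in the supremum norm. Its Feller generator is $\mathcal Af=\lim_{t\downarrow0}(P_tf-f)/t$ (limit in the supremum norm), with domain $\mathcal D_{\mathcal A}$ the set of $f\in C_\infty(\mathbb R^d)$ for which the limit exists. A Lévy-type process with symbol $q:\mathbb R^d\times\mathbb R^d\to\mathbb C$ is a Feller process such that $C_c^\infty(\mathbb R^d)\subseteq\mathcal D_{\mathcal A}$ and $$\mathcal Af(x)=-\int_{\mathbb R^d}q(x,\xi)\,e^{i\langle\xi,x\rangle}\hat f(\xi)\,d\xi,\qquad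 \hat f(\xi)=(2\pi)^{-d}\int_{\mathbb R^d}e^{-i\langle\xi,x\rangle}f(x)\,dx,$$ for all $f\in C_c^\infty(\mathbb R^d)$ and $x\in\mathbb R^d$ (with an absolutely convergent integral), where $q$ is measurable and locally bounded in $(x,\xi)$, and continuous and negative definite in $\xi$. Proposition. Let $F=\{F_t\}_{t\ge0}$ be a $d$-dimensional Lévy-type process with symbol $q_F(x,\xi)$. Then the space-time process $M_t=(t,F_t)$, that is, the process on $\mathbb R\times\Omega$ given for the starting point $(u,x)\in\mathbb R\times\mathbb R^d=\mathbb R^{d+1}$ by the law $\mathbb P_M^{(u,x)}=\delta_u\otimes\mathbb P_F^x$ and by $$M_t(u,\omega)=(u+t,F_t(\omega))\ \text{ if } F_t(\omega)\in\mathbb R^d,\qquad M_t(u,\omega)=\infty\ \text{ if } F_t(\omega)=\infty,$$ with filtration $\mathcal B(\mathbb R)\otimes\mathcal F_t$ and shifts $(u,\omega)\mapsto(u+t,\theta_t\omega)$, is a $(d+1)$-dimensional Lévy-type process with symbol $$q_M((u,x),(\zeta,\xi))=-i\zeta+q_F(x,\xi),\qquad u,\zeta\in\mathbb R,\ x,\xi\in\mathbb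 R^d.$$ If moreover all paths of $F$ are càdlàg in $\mathbb R^d\cup\{\infty\}$, then all paths of $M$ are càdlàg in $\mathbb R^{d+1}\cup\{\infty\}$. -/

import Mathlib

open MeasureTheory Filter Topology
open scoped NNReal ComplexOrder

noncomputable section

namespace LevyType

/-- Euclidean space of dimension `d`. -/
abbrev E (d : ℕ) : Type := EuclideanSpace ℝ (Fin d)

/-- The point `(u, x)` of the `(d+1)`-dimensional Euclidean space. -/
def pair {d : ℕ} (u : ℝ) (x : E d) : E (d + 1) :=
  WithLp.toLp 2 (Fin.cons u (fun i => x i) : Fin (d + 1) → ℝ)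

/-- The time component `u` of `z = (u, x)`. -/
def timePart {d : ℕ} (z : E (d + 1)) : ℝ := z 0

/-- The space component `x` of `z = (u, x)`. -/
def spacePart {d : ℕ} (z : E (d + 1)) : E d := WithLp.toLp 2 (fun i => z i.succ)

theorem pair_timePart_spacePart {d : ℕ} (z : E (d + 1)) :
    pair (timePart z) (spacePart z) = z := by
  ext i
  refine Fin.cases ?_ (fun j => ?_) i <;> simp [pair, timePart, spacePart]

theorem timePart_pair {d : ℕ} (u : ℝ) (x : E d) : timePart (pair u x) = u := by
  simp [pair, timePart]

theorem spacePart_pair {d : ℕ} (u : ℝ) (x : E d) : spacePart (pair u x) = x := by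
  ext i
  simp [pair, spacePart]

/-- Extension of a function on the state space by zero at the cemetery point. -/
def extendByZero {d : ℕ} (f : E d → ℝ) (y : OnePoint (E d)) : ℝ :=
  OnePoint.elim y (0 : ℝ) f

/-- The data `(Ω, 𝓕, (P_x), (𝓕_t), (θ_t), (X_t))` of a possibly killed process with state space
`ℝ^d`; the point at infinity of the one-point compactification is the cemetery. -/
structure ProcessData (d : ℕ) (Ω : Type*) [mΩ : MeasurableSpace Ω] where
  /-- the law of the process started at `x` -/
  P : E d → Measure Ω
  /-- the filtration -/
  ℱ : Filtration ℝ≥0 mΩ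
  /-- the shift operators -/
  θ : ℝ≥0 → Ω → Ω
  /-- the process -/
  X : ℝ≥0 → Ω → OnePoint (E d)

/-- Bounded Borel functions on `ℝ^d`. -/
def IsBoundedBorel {d : ℕ} (f : E d → ℝ) : Prop :=
  Measurable f ∧ ∃ C : ℝ, ∀ x, |f x| ≤ C

/-- Continuous functions on `ℝ^d` vanishing at infinity. -/
def IsVanishing {d : ℕ} (f : E d → ℝ) : Prop :=
  Continuous f ∧ Tendsto f (cocompact (E d)) (𝓝 0)

/-- Smooth functions on `ℝ^d` with compact support. -/
def IsTest {d : ℕ} (f : E d → ℝ) : Prop :=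
  ContDiff ℝ (⊤ : ℕ∞) f ∧ HasCompactSupport f

section

variable {d : ℕ} {Ω : Type*} [MeasurableSpace Ω]

/-- `P_t f (x) = E_x[f(X_t)]`, where `f` vanishes at the cemetery. -/
def semigroup (M : ProcessData d Ω) (t : ℝ≥0) (f : E d → ℝ) (x : E d) : ℝ :=
  ∫ ω, extendByZero f (M.X t ω) ∂(M.P x)

/-- Time-homogeneous Markov processes. Since functions are extended by zero to the cemetery, the
Markov property includes that the cemetery is absorbing. -/
structure IsMarkovProcess (M : ProcessData d Ω) : Prop where
  prob : ∀ x, IsProbabilityMeasure (M.P x)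
  adapted : ∀ (t : ℝ≥0) (B : Set (E d)), MeasurableSet B →
    MeasurableSet[M.ℱ t] {ω | M.X t ω ∈ (fun y : E d => (y : OnePoint (E d))) '' B}
  regular : ∀ (t : ℝ≥0) (B : Set (E d)), MeasurableSet B →
    Measurable fun x => M.P x {ω | M.X t ω ∈ (fun y : E d => (y : OnePoint (E d))) '' B}
  initial : ∀ x : E d, ∀ᵐ ω ∂(M.P x), M.X 0 ω = (x : OnePoint (E d))
  shift : ∀ (s t : ℝ≥0) (ω : Ω), M.X s (M.θ t ω) = M.X (t + s) ω
  markov : ∀ (x : E d) (s t : ℝ≥0) (f : E d → ℝ), IsBoundedBorel f →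
    (M.P x)[fun ω => extendByZero f (M.X (s + t) ω) | M.ℱ s]
      =ᵐ[M.P x] fun ω => extendByZero (semigroup M t f) (M.X s ω)

/-- Feller processes: the semigroup acts on the continuous functions vanishing at infinity and is
strongly continuous there for the supremum norm. -/
structure IsFellerProcess (M : ProcessData d Ω) : Prop where
  isMarkov : IsMarkovProcess M
  maps : ∀ (t : ℝ≥0) (f : E d → ℝ), IsVanishing f → IsVanishing (semigroup M t f)
  strongCont : ∀ f : E d → ℝ, IsVanishing f →
    TendstoUniformly (fun t : ℝ≥0 => semigroup M t f) f (𝓝[>] 0)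

/-- `f` belongs to the domain of the infinitesimal generator on bounded Borel functions, and `g` is
its image: `(P_t f - f)/t → g` in the supremum norm as `t ↓ 0`. -/
structure IsGeneratorPair (M : ProcessData d Ω) (f g : E d → ℝ) : Prop where
  left : IsBoundedBorel f
  right : IsBoundedBorel g
  lim : TendstoUniformly (fun (t : ℝ≥0) x => (semigroup M t f x - f x) / (t : ℝ)) g (𝓝[>] 0)

/-- `f` belongs to the domain of the Feller generator `A`, and `g = A f`. -/
def IsFellerGeneratorPair (M : ProcessData d Ω) (f g : E d → ℝ) : Prop :=
  IsVanishing f ∧ IsGeneratorPair M f g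

/-- The Fourier transform `(2π)^{-d} ∫ exp(-i⟨ξ,x⟩) f(x) dx`. -/
def fourier (f : E d → ℝ) (ξ : E d) : ℂ :=
  (((2 * Real.pi) ^ d)⁻¹ : ℝ) *
    ∫ x : E d, Complex.exp (-Complex.I * (inner ℝ ξ x : ℝ)) * (f x : ℂ)

/-- Negative definite functions: all matrices
`(ψ(ξ_j) + conj ψ(ξ_k) - ψ(ξ_j - ξ_k))_{j,k}` are positive semidefinite. -/
def IsNegativeDefinite (ψ : E d → ℂ) : Prop :=
  ∀ (n : ℕ) (ξ : Fin n → E d),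
    (Matrix.of fun j k => ψ (ξ j) + star (ψ (ξ k)) - ψ (ξ j - ξ k)).PosSemidef

/-- Admissible symbols: measurable and locally bounded in `(x, ξ)`, and continuous and negative
definite in `ξ`. -/
structure IsNegativeDefiniteSymbol (q : E d → E d → ℂ) : Prop where
  measurable : Measurable fun p : E d × E d => q p.1 p.2
  locallyBounded : ∀ K : Set (E d × E d), IsCompact K → ∃ C : ℝ, ∀ p ∈ K, ‖q p.1 p.2‖ ≤ C
  continuous : ∀ x, Continuous (q x)
  negDef : ∀ x, IsNegativeDefinite (q x)

/-- Lévy-type processes with symbol `q`: Feller processes whose Feller generator `A` is defined on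
all smooth compactly supported functions `f` and acts on them as
`A f (x) = - ∫ q(x,ξ) exp(i⟨ξ,x⟩) f̂(ξ) dξ`. -/
structure IsLevyTypeProcess (M : ProcessData d Ω) (q : E d → E d → ℂ) : Prop where
  isFeller : IsFellerProcess M
  symbol : IsNegativeDefiniteSymbol q
  generator : ∀ f : E d → ℝ, IsTest f → ∃ g : E d → ℝ, IsFellerGeneratorPair M f g ∧
    ∀ x : E d,
      Integrable (fun ξ : E d =>
        q x ξ * Complex.exp (Complex.I * (inner ℝ ξ x : ℝ)) * fourier f ξ) ∧
      (g x : ℂ) = -∫ ξ : E d,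
        q x ξ * Complex.exp (Complex.I * (inner ℝ ξ x : ℝ)) * fourier f ξ

/-- All paths are right-continuous with left limits in the one-point compactification. -/
def IsCadlag (M : ProcessData d Ω) : Prop :=
  ∀ (ω : Ω) (t : ℝ≥0),
    ContinuousWithinAt (fun s => M.X s ω) (Set.Ici t) t ∧
      ∃ l : OnePoint (E d), Tendsto (fun s => M.X s ω) (𝓝[<] t) (𝓝 l)

/-- The filtration `(𝓑(ℝ) ⊗ 𝓕_t)` on `ℝ × Ω`. -/
def spaceTimeFiltration {mΩ : MeasurableSpace Ω} (ℱ : Filtration ℝ≥0 mΩ) :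
    Filtration ℝ≥0 (inferInstance : MeasurableSpace (ℝ × Ω)) where
  seq t := MeasurableSpace.prod inferInstance (ℱ t)
  mono' _ _ hst := sup_le_sup le_rfl (MeasurableSpace.comap_mono (ℱ.mono hst))
  le' t := sup_le_sup le_rfl (MeasurableSpace.comap_mono (ℱ.le t))

/-- The space-time process of `F`, on `ℝ × Ω`, where the real coordinate is the initial time `u`:
under the law `δ_u ⊗ P_x` it is `t ↦ (u + t, F_t)`, killed when `F` is. In particular it is
`t ↦ (t, F_t)` when started at time `u = 0`. -/
def spaceTime (F : ProcessData d Ω) : ProcessData (d + 1) (ℝ × Ω) where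
  P z := (Measure.dirac (timePart z)).prod (F.P (spacePart z))
  ℱ := spaceTimeFiltration F.ℱ
  θ t p := (p.1 + (t : ℝ), F.θ t p.2)
  X t p := OnePoint.map (fun y => pair (p.1 + (t : ℝ)) y) (F.X t p.2)

end

end LevyType

end

noncomputable section

namespace LevyType

/-! ### Time and space coordinates on Euclidean space -/

section Geometry

variable {d : ℕ}

/-! Time runs deterministically, so the semigroup of the space-time process is `T_t f(u,x) =
P_t(f(u+t,·))(x)` (`semigroup_spaceTime`). The Markov and Feller properties then follow slice by
slice: the law is carried by a single start time, `P_t` is a contraction, and a function vanishing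
at infinity is uniformly continuous in time.

The generator should be `∂_u + A`, with `A` acting in space. Write `f_u = f(u,·)` and split `(T_t
f(u,x) - f(u,x))/t` as `P_t((f_{u+t} - f_u)/t)(x) + (P_t f_u(x) - f_u(x))/t`. The first term tends
to `∂_u f` by the mean value theorem and strong continuity. The second tends to `A f_u` for each
fixed `u`; the difficulty is uniformity in `u`. Since `f` has compact support, a finite net of times
suffices once the quotients are equicontinuous in `u`. This follows from `|P_t h - h| ≤ t sup|Ah|`
applied to `h = f_u - f_v`, together with a bound `|A f_u - A f_v| ≤ L|u - v|`
(`exists_lipschitz_generator_slice`).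

That bound has two regimes. For `x` in a large ball, `q(x,·)` grows at most quadratically, uniformly
in `x` (`norm_le_of_forall_norm_le_one`), and the spatial Fourier transform of `f_u` is Lipschitz in
`u` with integrable weights. For `x` outside, where no uniform bound on `q` is available, `|f_u -
f_v|` is dominated by a multiple of a fixed cutoff vanishing at `x`, and the positive maximum
principle applies (`abs_le_of_abs_le_mul`).

Finally, Fourier inversion turns `∂_u` into the symbol `-iζ`, and partial inversion in `ζ` with
Fubini identifies `A f_u` with the contribution of `q_F`. -/

theorem continuous_pair : Continuous fun p : ℝ × E d => pair p.1 p.2 := by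
  refine (PiLp.continuous_toLp 2 _).comp (continuous_pi fun i => ?_)
  refine Fin.cases ?_ (fun j => ?_) i
  · simpa using continuous_fst
  · exact (continuous_apply j).comp ((PiLp.continuous_ofLp 2 _).comp continuous_snd)

theorem continuous_timePart : Continuous (timePart (d := d)) :=
  (continuous_apply 0).comp (PiLp.continuous_ofLp 2 _)

theorem continuous_spacePart : Continuous (spacePart (d := d)) :=
  (PiLp.continuous_toLp 2 _).comp
    (continuous_pi fun i => (continuous_apply i.succ).comp (PiLp.continuous_ofLp 2 _))

/-- `ℝ × ℝ^d` is homeomorphic to `ℝ^(d+1)`. -/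
def pairHomeomorph (d : ℕ) : ℝ × E d ≃ₜ E (d + 1) where
  toFun p := pair p.1 p.2
  invFun z := (timePart z, spacePart z)
  left_inv p := by simp [timePart_pair, spacePart_pair]
  right_inv z := pair_timePart_spacePart z
  continuous_toFun := continuous_pair
  continuous_invFun := continuous_timePart.prodMk continuous_spacePart

theorem pair_add (u v : ℝ) (x y : E d) : pair (u + v) (x + y) = pair u x + pair v y := by
  ext i
  refine Fin.cases ?_ (fun j => ?_) i <;> simp [pair]

theorem pair_sub (u v : ℝ) (x y : E d) : pair (u - v) (x - y) = pair u x - pair v y := by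
  ext i
  refine Fin.cases ?_ (fun j => ?_) i <;> simp [pair]

theorem pair_smul (c u : ℝ) (x : E d) : pair (c * u) (c • x) = c • pair u x := by
  ext i
  refine Fin.cases ?_ (fun j => ?_) i <;> simp [pair]

theorem inner_pair (u v : ℝ) (x y : E d) :
    inner ℝ (pair u x) (pair v y) = u * v + inner ℝ x y := by
  simp [PiLp.inner_apply, Fin.sum_univ_succ, pair, mul_comm]

theorem norm_pair_sq (u : ℝ) (x : E d) : ‖pair u x‖ ^ 2 = u ^ 2 + ‖x‖ ^ 2 := by
  rw [← real_inner_self_eq_norm_sq, inner_pair, real_inner_self_eq_norm_sq]; ring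

theorem norm_le_norm_pair (u : ℝ) (x : E d) : ‖x‖ ≤ ‖pair u x‖ :=
  le_of_sq_le_sq (by rw [norm_pair_sq]; nlinarith [sq_nonneg u]) (norm_nonneg _)

theorem abs_le_norm_pair (u : ℝ) (x : E d) : |u| ≤ ‖pair u x‖ :=
  le_of_sq_le_sq (by rw [norm_pair_sq, sq_abs]; nlinarith [sq_nonneg ‖x‖]) (norm_nonneg _)

theorem norm_pair_zero (u : ℝ) : ‖pair u (0 : E d)‖ = |u| := by
  have h := norm_pair_sq u (0 : E d)
  rw [norm_zero, zero_pow two_ne_zero, add_zero, ← sq_abs u] at h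
  exact (sq_eq_sq₀ (norm_nonneg _) (abs_nonneg _)).1 h

theorem dist_pair_left (u v : ℝ) (x : E d) : dist (pair u x) (pair v x) = |u - v| := by
  rw [dist_eq_norm, ← pair_sub, sub_self, norm_pair_zero]

theorem pair_eq_add_smul (u v : ℝ) (x : E d) : pair u x = pair v x + (u - v) • pair 1 0 := by
  rw [← pair_smul, ← pair_add]; simp

/-- Lebesgue measure is a product measure in coordinates, and prepending a coordinate is
`piFinSuccAbove` at index `0`. All uses of Fubini in frequency and in space-time go through this. -/
theorem measurePreserving_pair :
    MeasurePreserving (fun p : ℝ × E d => pair p.1 p.2) volume volume := by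
  have h1 : MeasurePreserving (fun p : ℝ × E d => (p.1, (WithLp.ofLp p.2 : Fin d → ℝ)))
      volume volume :=
    (MeasurePreserving.id volume).prod (PiLp.volume_preserving_ofLp (Fin d))
  have h2 := (volume_preserving_piFinSuccAbove (fun _ : Fin (d + 1) => ℝ) 0).symm
  have h3 := PiLp.volume_preserving_toLp (Fin (d + 1))
  have h : (fun p : ℝ × E d => pair p.1 p.2) = WithLp.toLp 2 ∘
      ⇑(MeasurableEquiv.piFinSuccAbove (fun _ : Fin (d + 1) => ℝ) 0).symm ∘
        fun p => (p.1, p.2.ofLp) := by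
    funext p
    simp [pair, MeasurableEquiv.piFinSuccAbove, Fin.insertNthEquiv]
  rw [h]
  exact h3.comp (h2.comp h1)

theorem measurableEmbedding_pair : MeasurableEmbedding fun p : ℝ × E d => pair p.1 p.2 :=
  (pairHomeomorph d).measurableEmbedding

end Geometry

/-! ### Measurability of killed processes and transition kernels -/

section Measurability

variable {d : ℕ} {Ω : Type*} [mΩ : MeasurableSpace Ω]

@[simp] theorem extendByZero_infty (f : E d → ℝ) :
    extendByZero f (OnePoint.infty : OnePoint (E d)) = 0 := rfl

@[simp] theorem extendByZero_coe (f : E d → ℝ) (x : E d) :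
    extendByZero f (x : OnePoint (E d)) = f x := rfl

/-- The event that the process is not killed up to time `t`. -/
def ProcessData.alive (M : ProcessData d Ω) (t : ℝ≥0) : Set Ω :=
  {ω | M.X t ω ∈ (fun y : E d => (y : OnePoint (E d))) '' Set.univ}

/-- The position at time `t`, with value `0` after killing. -/
def ProcessData.position (M : ProcessData d Ω) (t : ℝ≥0) (ω : Ω) : E d :=
  OnePoint.elim (M.X t ω) 0 id

theorem mem_coe_image_iff (M : ProcessData d Ω) (t : ℝ≥0) (ω : Ω) (B : Set (E d)) :
    M.X t ω ∈ (fun y : E d => (y : OnePoint (E d))) '' B ↔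
      ω ∈ M.alive t ∧ M.position t ω ∈ B := by
  unfold ProcessData.alive ProcessData.position
  rw [Set.mem_ofPred_eq]
  induction M.X t ω using OnePoint.rec with
  | infty => simp
  | coe x => simp

/-- Measurability is given only for events of being alive in a Borel set of `ℝ^d`. This form reduces
everything to a measurable alive event and a position in `ℝ^d`, avoiding any σ-algebra on the
compactification. -/
theorem extendByZero_eq_indicator (M : ProcessData d Ω) (t : ℝ≥0) (ω : Ω) (f : E d → ℝ) :
    extendByZero f (M.X t ω) = (M.alive t).indicator (fun ω => f (M.position t ω)) ω := by
  classical
  rw [Set.indicator_apply]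
  unfold ProcessData.alive ProcessData.position
  rw [Set.mem_ofPred_eq]
  induction M.X t ω using OnePoint.rec with
  | infty => simp
  | coe x => simp

theorem abs_extendByZero_le {f : E d → ℝ} {C : ℝ} (hC : 0 ≤ C) (hf : ∀ x, |f x| ≤ C)
    (y : OnePoint (E d)) : |extendByZero f y| ≤ C := by
  induction y using OnePoint.rec with
  | infty => simpa using hC
  | coe x => simpa using hf x

theorem IsBoundedBorel.exists_nonneg_bound {f : E d → ℝ} (hf : IsBoundedBorel f) :
    ∃ C : ℝ, 0 ≤ C ∧ ∀ x, |f x| ≤ C := by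
  obtain ⟨C, hC⟩ := hf.2
  exact ⟨C, (abs_nonneg _).trans (hC 0), hC⟩

theorem measurable_indicator_snd {α β : Type*} [MeasurableSpace α] [MeasurableSpace β]
    {A : Set α} (hA : MeasurableSet A) {Y : α → β} (hY : Measurable Y) {g : ℝ × β → ℝ}
    (hg : Measurable g) :
    Measurable ((Prod.snd ⁻¹' A).indicator fun p : ℝ × α => g (p.1, Y p.2)) :=
  (hg.comp (measurable_fst.prodMk (hY.comp measurable_snd))).indicator (measurable_snd hA)

namespace IsMarkovProcess

variable {M : ProcessData d Ω} (hM : IsMarkovProcess M)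

include hM

theorem measurableSet_alive (t : ℝ≥0) : MeasurableSet[M.ℱ t] (M.alive t) :=
  hM.adapted t _ MeasurableSet.univ

theorem measurable_position (t : ℝ≥0) : Measurable[M.ℱ t] (M.position t) := by
  intro B hB
  have h : M.position t ⁻¹' B =
      {ω | M.X t ω ∈ (fun y : E d => (y : OnePoint (E d))) '' B} ∪
        ((M.alive t)ᶜ ∩ {_ω | (0 : E d) ∈ B}) := by
    ext ω
    simp only [Set.mem_union, Set.mem_ofPred_eq, mem_coe_image_iff, Set.mem_inter_iff,
      Set.mem_compl_iff, Set.mem_preimage]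
    by_cases hω : ω ∈ M.alive t
    · simp [hω]
    · have h0 : M.position t ω = 0 := by
        have hx : M.X t ω = OnePoint.infty := by
          by_contra hne
          obtain ⟨x, hx⟩ := OnePoint.ne_infty_iff_exists.1 hne
          exact hω ⟨x, trivial, hx⟩
        simp [ProcessData.position, hx]
      simp [hω, h0]
  rw [h]
  refine MeasurableSet.union (hM.adapted t B hB)
    (MeasurableSet.inter (hM.measurableSet_alive t).compl ?_)
  by_cases h0 : (0 : E d) ∈ B <;> simp [h0]

/-- Joint measurability in the start time and the path, for `𝓑(ℝ) ⊗ 𝓕_t`; adaptedness of the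
space-time process comes from here. -/
theorem measurable_extendByZero_prod (t : ℝ≥0) {g : ℝ × E d → ℝ} (hg : Measurable g) :
    @Measurable _ _ (MeasurableSpace.prod inferInstance (M.ℱ t)) _
      fun p : ℝ × Ω => extendByZero (fun y => g (p.1, y)) (M.X t p.2) := by
  have h : (fun p : ℝ × Ω => extendByZero (fun y => g (p.1, y)) (M.X t p.2)) =
      (Prod.snd ⁻¹' M.alive t).indicator fun p : ℝ × Ω => g (p.1, M.position t p.2) := by
    classical
    funext p
    rw [extendByZero_eq_indicator, Set.indicator_apply, Set.indicator_apply]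
    rfl
  rw [h]
  exact @measurable_indicator_snd _ _ (M.ℱ t) _ _ (hM.measurableSet_alive t) _
    (hM.measurable_position t) _ hg

theorem measurable_extendByZero (t : ℝ≥0) {f : E d → ℝ} (hf : Measurable f) :
    Measurable[M.ℱ t] fun ω => extendByZero f (M.X t ω) := by
  exact @Measurable.comp _ _ _ (M.ℱ t) (MeasurableSpace.prod inferInstance (M.ℱ t)) _ _ _
    (hM.measurable_extendByZero_prod t (hf.comp measurable_snd))
    (@measurable_prodMk_left _ _ _ (M.ℱ t) (0 : ℝ))

theorem integrable_extendByZero (t : ℝ≥0) {f : E d → ℝ} (hf : IsBoundedBorel f) (x : E d) :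
    Integrable (fun ω => extendByZero f (M.X t ω)) (M.P x) := by
  have := hM.prob x
  obtain ⟨C, hC0, hC⟩ := hf.exists_nonneg_bound
  exact Integrable.of_bound
    (((hM.measurable_extendByZero t hf.1).mono (M.ℱ.le t) le_rfl).aestronglyMeasurable) C
    (Eventually.of_forall fun ω => abs_extendByZero_le hC0 hC _)

/-- The sub-Markov transition kernel at time `t`. -/
def kernel (t : ℝ≥0) : ProbabilityTheory.Kernel (E d) (E d) where
  toFun x := ((M.P x).restrict (M.alive t)).map (M.position t)
  measurable' := by
    refine Measure.measurable_of_measurable_coe _ fun B hB => ?_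
    have hp : Measurable (M.position t) := (hM.measurable_position t).mono (M.ℱ.le t) le_rfl
    convert hM.regular t B hB using 2 with x
    rw [Measure.map_apply hp hB, Measure.restrict_apply (hp hB)]
    congr 1
    ext ω
    rw [Set.mem_ofPred_eq, mem_coe_image_iff, and_comm]
    rfl

theorem kernel_apply_apply (t : ℝ≥0) (x : E d) {B : Set (E d)} (hB : MeasurableSet B) :
    hM.kernel t x B = M.P x {ω | M.X t ω ∈ (fun y : E d => (y : OnePoint (E d))) '' B} := by
  have hp : Measurable (M.position t) := (hM.measurable_position t).mono (M.ℱ.le t) le_rfl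
  change ((M.P x).restrict (M.alive t)).map (M.position t) B = _
  rw [Measure.map_apply hp hB, Measure.restrict_apply (hp hB)]
  congr 1
  ext ω
  rw [Set.mem_ofPred_eq, mem_coe_image_iff, and_comm]
  rfl

theorem isFiniteKernel_kernel (t : ℝ≥0) : ProbabilityTheory.IsFiniteKernel (hM.kernel t) := by
  refine ⟨⟨1, ENNReal.one_lt_top, fun x => ?_⟩⟩
  have := hM.prob x
  rw [hM.kernel_apply_apply t x MeasurableSet.univ]
  exact prob_le_one

theorem semigroup_eq_integral_kernel (t : ℝ≥0) {f : E d → ℝ} (hf : Measurable f) (x : E d) :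
    semigroup M t f x = ∫ y, f y ∂(hM.kernel t x) := by
  have hp : Measurable (M.position t) := (hM.measurable_position t).mono (M.ℱ.le t) le_rfl
  change _ = ∫ y, f y ∂(((M.P x).restrict (M.alive t)).map (M.position t))
  rw [integral_map hp.aemeasurable hf.aestronglyMeasurable,
    ← integral_indicator (M.ℱ.le t _ (hM.measurableSet_alive t))]
  exact integral_congr_ae (Eventually.of_forall fun ω => extendByZero_eq_indicator M t ω f)

end IsMarkovProcess

end Measurability

/-! ### Markov property and paths of the space-time process -/

section SpaceTimeMarkov

variable {d : ℕ} {Ω : Type*} [mΩ : MeasurableSpace Ω]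

theorem extendByZero_map {d' : ℕ} (f : E d' → ℝ) (g : E d → E d') (y : OnePoint (E d)) :
    extendByZero f (OnePoint.map g y) = extendByZero (fun x => f (g x)) y := by
  induction y using OnePoint.rec with
  | infty => rfl
  | coe x => rfl

theorem map_mem_coe_image_iff {d' : ℕ} (g : E d → E d') (y : OnePoint (E d)) (B : Set (E d')) :
    OnePoint.map g y ∈ (fun x : E d' => (x : OnePoint (E d'))) '' B ↔
      y ∈ (fun x : E d => (x : OnePoint (E d))) '' (g ⁻¹' B) := by
  induction y using OnePoint.rec with
  | infty => simp
  | coe x => simp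

theorem measurable_pair : Measurable fun p : ℝ × E d => pair p.1 p.2 :=
  continuous_pair.measurable

theorem continuous_pair_right (u : ℝ) : Continuous fun x : E d => pair u x :=
  continuous_pair.comp (continuous_const.prodMk continuous_id)

theorem continuous_pair_left (x : E d) : Continuous fun u : ℝ => pair u x :=
  continuous_pair.comp (continuous_id.prodMk continuous_const)

theorem IsBoundedBorel.slice {f : E (d + 1) → ℝ} (hf : IsBoundedBorel f) (u : ℝ) :
    IsBoundedBorel fun x : E d => f (pair u x) :=
  ⟨hf.1.comp (continuous_pair_right u).measurable, hf.2.imp fun _ hC _ => hC _⟩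

theorem spaceTime_P (F : ProcessData d Ω) [∀ x, IsProbabilityMeasure (F.P x)]
    (z : E (d + 1)) :
    (spaceTime F).P z = (F.P (spacePart z)).map (Prod.mk (timePart z)) :=
  Measure.dirac_prod _

theorem setIntegral_spaceTime (F : ProcessData d Ω) [∀ x, IsProbabilityMeasure (F.P x)]
    (z : E (d + 1)) (A : Set (ℝ × Ω)) (h : ℝ × Ω → ℝ) :
    ∫ p in A, h p ∂((spaceTime F).P z) =
      ∫ ω in Prod.mk (timePart z) ⁻¹' A, h (timePart z, ω) ∂(F.P (spacePart z)) := by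
  rw [spaceTime_P, (measurableEmbedding_prodMk_left (timePart z)).setIntegral_map]

/-- The law lives on the fibre over the start time, where the time coordinate at `t` is constant.
Every later estimate on the space-time semigroup starts from this identity. -/
theorem semigroup_spaceTime (F : ProcessData d Ω) [∀ x, IsProbabilityMeasure (F.P x)]
    (t : ℝ≥0) (f : E (d + 1) → ℝ) (z : E (d + 1)) :
    semigroup (spaceTime F) t f z =
      semigroup F t (fun y => f (pair (timePart z + t) y)) (spacePart z) := by
  unfold semigroup
  rw [spaceTime_P, (measurableEmbedding_prodMk_left (timePart z)).integral_map]
  exact integral_congr_ae (Eventually.of_forall fun ω => extendByZero_map _ _ _)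

theorem abs_semigroup_le {M : ProcessData d Ω} (hM : IsMarkovProcess M) (t : ℝ≥0)
    {f : E d → ℝ} {C : ℝ} (hC : 0 ≤ C) (hf : ∀ x, |f x| ≤ C) (x : E d) :
    |semigroup M t f x| ≤ C := by
  have := hM.prob x
  simpa [semigroup] using norm_integral_le_of_norm_le_const (μ := M.P x)
    (f := fun ω => extendByZero f (M.X t ω))
    (Eventually.of_forall fun ω => abs_extendByZero_le hC hf (M.X t ω))

namespace IsMarkovProcess

variable {F : ProcessData d Ω} (hF : IsMarkovProcess F)

include hF

/-- The integrand itself depends on the start time, so measurability is obtained from a parametrised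
integral against the transition kernel, not slice by slice. -/
theorem isBoundedBorel_semigroup_spaceTime (t : ℝ≥0) {f : E (d + 1) → ℝ}
    (hf : IsBoundedBorel f) : IsBoundedBorel (semigroup (spaceTime F) t f) := by
  have := hF.prob
  obtain ⟨C, hC0, hC⟩ := hf.exists_nonneg_bound
  refine ⟨?_, C, fun z => ?_⟩
  · have := hF.isFiniteKernel_kernel t
    have h : semigroup (spaceTime F) t f = fun z =>
        ∫ y, f (pair (timePart z + t) y) ∂((hF.kernel t).comap spacePart
          continuous_spacePart.measurable z) := by
      funext z
      rw [semigroup_spaceTime, hF.semigroup_eq_integral_kernel t (hf.slice _).1]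
      rfl
    rw [h]
    have hg : Measurable fun p : E (d + 1) × E d => f (pair (timePart p.1 + t) p.2) :=
      hf.1.comp (measurable_pair.comp
        (((continuous_timePart.measurable.comp measurable_fst).add_const _).prodMk measurable_snd))
    exact (StronglyMeasurable.integral_kernel_prod_right hg.stronglyMeasurable).measurable
  · rw [semigroup_spaceTime]
    exact abs_semigroup_le hF t hC0 (fun x => hC _) _

theorem spaceTime : IsMarkovProcess (spaceTime F) := by
  have := hF.prob
  have hprob : ∀ z, IsProbabilityMeasure ((LevyType.spaceTime F).P z) := fun z => by
    unfold LevyType.spaceTime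
    infer_instance
  have hmeas : ∀ (t : ℝ≥0) {g : E (d + 1) → ℝ}, Measurable g →
      Measurable[(LevyType.spaceTime F).ℱ t]
        fun p : ℝ × Ω => extendByZero g ((LevyType.spaceTime F).X t p) := fun t g hg => by
    have h := hF.measurable_extendByZero_prod t (g := fun p => g (pair (p.1 + (t : ℝ)) p.2))
      (hg.comp (measurable_pair.comp ((measurable_fst.add_const _).prodMk measurable_snd)))
    exact (funext fun p : ℝ × Ω => extendByZero_map g _ (F.X t p.2)) ▸ h
  refine ⟨hprob, fun t B hB => ?_, fun t B hB => ?_, fun z => ?_, fun s t p => ?_,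
    fun z s t f hf => ?_⟩
  · classical
    -- The indicator of `B` extended by zero equals `1` exactly when the process is alive and in
    -- `B`.
    have h := hmeas t (measurable_one.indicator hB : Measurable (B.indicator (1 : E (d + 1) → ℝ)))
    convert h (measurableSet_singleton (1 : ℝ)) using 1
    ext p
    rw [Set.mem_ofPred_eq, Set.mem_preimage]
    induction (LevyType.spaceTime F).X t p using OnePoint.rec with
    | infty => simp
    | coe x => simp [Set.indicator_apply]
  · have := hF.isFiniteKernel_kernel t
    have h : (fun z => (LevyType.spaceTime F).P z {p | (LevyType.spaceTime F).X t p ∈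
        (fun y : E (d + 1) => (y : OnePoint (E (d + 1)))) '' B}) = fun z =>
        ((hF.kernel t).comap spacePart continuous_spacePart.measurable z)
          (Prod.mk z ⁻¹' {p : E (d + 1) × E d | pair (timePart p.1 + t) p.2 ∈ B}) := by
      funext z
      rw [spaceTime_P, (measurableEmbedding_prodMk_left (timePart z)).map_apply]
      refine Eq.trans ?_ (hF.kernel_apply_apply t (spacePart z)
        ((continuous_pair_right (timePart z + t)).measurable hB)).symm
      congr 1
      ext ω
      exact map_mem_coe_image_iff _ _ _
    rw [h]
    refine ProbabilityTheory.Kernel.measurable_kernel_prodMk_left ?_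
    exact (measurable_pair.comp
      (((continuous_timePart.measurable.comp measurable_fst).add_const _).prodMk measurable_snd)) hB
  · rw [spaceTime_P, (measurableEmbedding_prodMk_left (timePart z)).ae_map_iff]
    filter_upwards [hF.initial (spacePart z)] with ω hω
    change OnePoint.map _ (F.X 0 ω) = _
    rw [hω, OnePoint.map_some]
    simp [pair_timePart_spacePart]
  · change OnePoint.map _ (F.X s (F.θ t p.2)) = OnePoint.map _ (F.X (t + s) p.2)
    rw [hF.shift]
    congr 1
    funext y
    rw [NNReal.coe_add, ← add_assoc]
    rfl
  · set x := spacePart z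
    set u := timePart z
    have hint : ∀ (r : ℝ≥0) {g : E (d + 1) → ℝ}, IsBoundedBorel g →
        Integrable (fun p => extendByZero g ((LevyType.spaceTime F).X r p))
          ((LevyType.spaceTime F).P z) := fun r g hg => by
      obtain ⟨C, hC0, hC⟩ := hg.exists_nonneg_bound
      exact Integrable.of_bound ((hmeas r hg.1).mono
        ((LevyType.spaceTime F).ℱ.le r) le_rfl).aestronglyMeasurable C
        (Eventually.of_forall fun ω => abs_extendByZero_le hC0 hC _)
    have hPf := hF.isBoundedBorel_semigroup_spaceTime t hf
    -- The conditional expectation is tested on `A` in `𝓑(ℝ) ⊗ 𝓕_s`. Under the Dirac law only the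
    -- section of `A` at `u` matters; it lies in `𝓕_s`, so the Markov property of `F` applies to the
    -- slice of `f` at time `u + s + t`.
    refine (ae_eq_condExp_of_forall_setIntegral_eq ((LevyType.spaceTime F).ℱ.le s) (hint _ hf)
      (fun A _ _ => (hint s hPf).integrableOn) (fun A hA _ => ?_)
      (hmeas s hPf.1).aestronglyMeasurable).symm
    rw [setIntegral_spaceTime, setIntegral_spaceTime]
    have hA' : MeasurableSet[F.ℱ s] (Prod.mk u ⁻¹' A) :=
      @measurable_prodMk_left _ _ _ (F.ℱ s) u A hA
    have hfs := hf.slice (u + (s + t : ℝ≥0))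
    have h1 := setIntegral_condExp (F.ℱ.le s) (hF.integrable_extendByZero (s + t) hfs x) hA'
    rw [setIntegral_congr_ae (F.ℱ.le s _ hA') ((hF.markov x s t _ hfs).mono fun ω h _ => h)] at h1
    refine Eq.trans ?_ (h1.trans ?_)
    · refine integral_congr_ae (Eventually.of_forall fun ω => ?_)
      refine (extendByZero_map _ _ _).trans ?_
      refine congrArg (fun g => extendByZero g (F.X s ω)) (funext fun y => ?_)
      rw [semigroup_spaceTime, timePart_pair, spacePart_pair, NNReal.coe_add, add_assoc]
    · exact integral_congr_ae (Eventually.of_forall fun ω => (extendByZero_map _ _ _).symm)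

end IsMarkovProcess

/-- Continuity at the cemetery needs no control of time: a compact subset of `ℝ^(d+1)` has compact
spatial projection, and points outside that projection avoid the set at every time. At finite points
the open embedding of `ℝ × ℝ^d` reduces the claim to continuity of `pair`. -/
theorem continuous_map_pair :
    Continuous fun p : ℝ × OnePoint (E d) => OnePoint.map (fun y => pair p.1 y) p.2 := by
  rw [continuous_iff_continuousAt]
  rintro ⟨v, y⟩
  induction y using OnePoint.rec with
  | infty =>
    rw [ContinuousAt, OnePoint.map_infty, OnePoint.hasBasis_nhds_infty.tendsto_right_iff]
    rintro K ⟨hKc, hK⟩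
    have hK' : IsCompact (spacePart '' K) := hK.image continuous_spacePart
    have hU : ((fun y : E d => (y : OnePoint (E d))) '' (spacePart '' K)ᶜ ∪ {OnePoint.infty}) ∈
        𝓝 (OnePoint.infty : OnePoint (E d)) :=
      OnePoint.hasBasis_nhds_infty.mem_of_mem ⟨hK'.isClosed, hK'⟩
    filter_upwards [prod_mem_nhds univ_mem hU] with p hp
    obtain ⟨w, y⟩ := p
    obtain ⟨-, hy⟩ := hp
    induction y using OnePoint.rec with
    | infty => exact Or.inr rfl
    | coe y =>
      simp only [Set.mem_union, Set.mem_image, OnePoint.coe_eq_coe, exists_eq_right,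
        Set.mem_singleton_iff, OnePoint.coe_ne_infty, or_false] at hy
      exact Or.inl ⟨pair w y, fun h => hy ⟨_, h, spacePart_pair w y⟩, rfl⟩
  | coe y =>
    have h := (OnePoint.isOpenEmbedding_coe (X := E d))
    have hid := (IsOpenEmbedding.id (X := ℝ)).prodMap h
    have := hid.continuousAt_iff (g := fun p : ℝ × OnePoint (E d) =>
      OnePoint.map (fun y => pair p.1 y) p.2) (x := (v, y))
    refine this.1 ?_
    exact (OnePoint.continuous_coe.comp continuous_pair).continuousAt

theorem IsCadlag.spaceTime {F : ProcessData d Ω} (hF : IsCadlag F) : IsCadlag (spaceTime F) := by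
  rintro ⟨u, ω⟩ t
  obtain ⟨h1, l, h2⟩ := hF ω t
  have ht : Continuous fun s : ℝ≥0 => u + (s : ℝ) := by fun_prop
  refine ⟨?_, OnePoint.map (fun y => pair (u + t) y) l, ?_⟩
  · exact (continuous_map_pair.continuousAt.tendsto.comp
      ((ht.continuousWithinAt (s := Set.Ici t) (x := t)).prodMk h1).tendsto)
  · exact (continuous_map_pair.tendsto (u + (t : ℝ), l)).comp
      (((ht.tendsto t).mono_left nhdsWithin_le_nhds).prodMk_nhds h2)

end SpaceTimeMarkov

/-! ### Semigroup estimates and the Feller property -/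

section Semigroup

variable {d : ℕ} {Ω : Type*} [mΩ : MeasurableSpace Ω]

theorem IsBoundedBorel.add {f g : E d → ℝ} (hf : IsBoundedBorel f) (hg : IsBoundedBorel g) :
    IsBoundedBorel fun x => f x + g x := by
  obtain ⟨C, hC⟩ := hf.2
  obtain ⟨D, hD⟩ := hg.2
  exact ⟨hf.1.add hg.1, C + D, fun x => (abs_add_le _ _).trans (add_le_add (hC x) (hD x))⟩

theorem IsBoundedBorel.const_mul {f : E d → ℝ} (hf : IsBoundedBorel f) (c : ℝ) :
    IsBoundedBorel fun x => c * f x := by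
  obtain ⟨C, hC⟩ := hf.2
  exact ⟨hf.1.const_mul c, |c| * C, fun x => by
    rw [abs_mul]; exact mul_le_mul_of_nonneg_left (hC x) (abs_nonneg c)⟩

theorem IsBoundedBorel.sub {f g : E d → ℝ} (hf : IsBoundedBorel f) (hg : IsBoundedBorel g) :
    IsBoundedBorel fun x => f x - g x := by
  simpa [sub_eq_add_neg] using hf.add (hg.const_mul (-1))

theorem isBoundedBorel_const (c : ℝ) : IsBoundedBorel fun _ : E d => c :=
  ⟨measurable_const, |c|, fun _ => le_rfl⟩

theorem extendByZero_add (f g : E d → ℝ) (y : OnePoint (E d)) :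
    extendByZero (fun x => f x + g x) y = extendByZero f y + extendByZero g y := by
  induction y using OnePoint.rec <;> simp

theorem extendByZero_const_mul (c : ℝ) (f : E d → ℝ) (y : OnePoint (E d)) :
    extendByZero (fun x => c * f x) y = c * extendByZero f y := by
  induction y using OnePoint.rec <;> simp

theorem extendByZero_mono {f g : E d → ℝ} (h : ∀ x, f x ≤ g x) (y : OnePoint (E d)) :
    extendByZero f y ≤ extendByZero g y := by
  induction y using OnePoint.rec with
  | infty => simp
  | coe x => simpa using h x

namespace IsMarkovProcess

variable {M : ProcessData d Ω} (hM : IsMarkovProcess M) (t : ℝ≥0) {f g : E d → ℝ}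

include hM

theorem semigroup_add (hf : IsBoundedBorel f) (hg : IsBoundedBorel g) (x : E d) :
    semigroup M t (fun y => f y + g y) x = semigroup M t f x + semigroup M t g x := by
  unfold semigroup
  rw [← integral_add (hM.integrable_extendByZero t hf x) (hM.integrable_extendByZero t hg x)]
  simp only [extendByZero_add]

omit hM in
theorem semigroup_const_mul (c : ℝ) (f : E d → ℝ) (x : E d) :
    semigroup M t (fun y => c * f y) x = c * semigroup M t f x := by
  unfold semigroup
  simp only [extendByZero_const_mul, integral_const_mul]

theorem semigroup_sub (hf : IsBoundedBorel f) (hg : IsBoundedBorel g) (x : E d) :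
    semigroup M t (fun y => f y - g y) x = semigroup M t f x - semigroup M t g x := by
  have h := hM.semigroup_add t hf (hg.const_mul (-1)) x
  rw [semigroup_const_mul] at h
  simpa [sub_eq_add_neg] using h

theorem semigroup_mono (hf : IsBoundedBorel f) (hg : IsBoundedBorel g) (h : ∀ y, f y ≤ g y)
    (x : E d) : semigroup M t f x ≤ semigroup M t g x :=
  integral_mono (hM.integrable_extendByZero t hf x) (hM.integrable_extendByZero t hg x)
    fun _ => extendByZero_mono h _

theorem abs_semigroup_le_semigroup (hf : IsBoundedBorel f) (hg : IsBoundedBorel g)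
    (h : ∀ y, |f y| ≤ g y) (x : E d) : |semigroup M t f x| ≤ semigroup M t g x := by
  refine abs_le'.2 ⟨hM.semigroup_mono t hf hg (fun y => (le_abs_self _).trans (h y)) x, ?_⟩
  have h1 := hM.semigroup_mono t (hf.const_mul (-1)) hg
    (fun y => by simpa using (neg_le_abs _).trans (h y)) x
  rw [semigroup_const_mul] at h1
  simpa using h1

theorem abs_semigroup_sub_le (hf : IsBoundedBorel f) (hg : IsBoundedBorel g) {C : ℝ}
    (hC : 0 ≤ C) (h : ∀ y, |f y - g y| ≤ C) (x : E d) :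
    |semigroup M t f x - semigroup M t g x| ≤ C := by
  rw [← hM.semigroup_sub t hf hg]
  exact abs_semigroup_le hM t hC h x

theorem isBoundedBorel_semigroup (hf : IsBoundedBorel f) : IsBoundedBorel (semigroup M t f) := by
  obtain ⟨C, hC0, hC⟩ := hf.exists_nonneg_bound
  refine ⟨?_, C, abs_semigroup_le hM t hC0 hC⟩
  have := hM.isFiniteKernel_kernel t
  rw [funext (hM.semigroup_eq_integral_kernel t hf.1)]
  exact (StronglyMeasurable.integral_kernel_prod_right
    (f := fun _ y => f y) (hf.1.comp measurable_snd).stronglyMeasurable).measurable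

theorem semigroup_comp (s : ℝ≥0) (hf : IsBoundedBorel f) (x : E d) :
    semigroup M (s + t) f x = semigroup M s (semigroup M t f) x := by
  have := hM.prob x
  unfold semigroup
  rw [← integral_condExp (M.ℱ.le s)]
  exact integral_congr_ae (hM.markov x s t f hf)

end IsMarkovProcess

theorem IsVanishing.isBoundedBorel {f : E d → ℝ} (hf : IsVanishing f) : IsBoundedBorel f := by
  let g : ZeroAtInftyContinuousMap (E d) ℝ := ⟨⟨f, hf.1⟩, hf.2⟩
  exact ⟨hf.1.measurable, ‖g.toBCF‖, fun x => g.toBCF.norm_coe_le_norm x⟩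

theorem IsVanishing.exists_forall_lt {f : E d → ℝ} (hf : IsVanishing f) {ε : ℝ} (hε : 0 < ε) :
    ∃ R : ℝ, 0 < R ∧ ∀ x, R ≤ ‖x‖ → |f x| < ε := by
  have h := hf.2
  rw [← Metric.cobounded_eq_cocompact, Metric.tendsto_nhds] at h
  obtain ⟨R, -, hR⟩ := (hasBasis_cobounded_norm (E := E d)).eventually_iff.1 (h ε hε)
  refine ⟨max R 1, lt_max_of_lt_right one_pos, fun x hx => ?_⟩
  simpa using hR ((le_max_left _ _).trans hx)

theorem IsVanishing.slice {f : E (d + 1) → ℝ} (hf : IsVanishing f) (u : ℝ) :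
    IsVanishing fun x : E d => f (pair u x) := by
  refine ⟨hf.1.comp (continuous_pair_right u), hf.2.comp ?_⟩
  rw [← Metric.cobounded_eq_cocompact, ← Metric.cobounded_eq_cocompact,
    ← tendsto_norm_atTop_iff_cobounded]
  exact tendsto_atTop_mono (norm_le_norm_pair u) tendsto_norm_cobounded_atTop

theorem IsVanishing.exists_forall_slice_lt {f : E (d + 1) → ℝ} (hf : IsVanishing f) {ε : ℝ}
    (hε : 0 < ε) : ∃ δ > 0, ∀ u v, |u - v| < δ → ∀ x, |f (pair u x) - f (pair v x)| < ε := by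
  obtain ⟨δ, hδ, h⟩ := Metric.uniformContinuous_iff.1
    (hf.1.uniformContinuous_of_tendsto_cocompact hf.2) ε hε
  exact ⟨δ, hδ, fun u v huv x => h (by rwa [dist_pair_left])⟩

theorem IsTest.isVanishing {f : E d → ℝ} (hf : IsTest f) : IsVanishing f :=
  ⟨hf.1.continuous, hf.2.is_zero_at_infty⟩

theorem exists_isTest_cutoff (d : ℕ) {R : ℝ} (hR : 0 < R) :
    ∃ χ : E d → ℝ, IsTest χ ∧ (∀ x, 0 ≤ χ x) ∧ (∀ x, χ x ≤ 1) ∧ (∀ x, ‖x‖ ≤ R → χ x = 1) ∧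
      ∀ x, R + 1 ≤ ‖x‖ → χ x = 0 := by
  let b : ContDiffBump (0 : E d) := ⟨R, R + 1, hR, by linarith⟩
  refine ⟨b, ⟨b.contDiff, b.hasCompactSupport⟩, fun x => b.nonneg, fun x => b.le_one,
    fun x hx => b.one_of_mem_closedBall (by simpa using hx), fun x hx => b.zero_of_le_dist ?_⟩
  simpa using hx

/-- Uniform convergence in a parameter `u ∈ ℝ`, from equicontinuity in `u` and smallness at
infinity. -/
theorem eventually_forall_abs_lt_of_equicontinuous {ι α : Type*} {l : Filter ι}
    {G : ι → ℝ → α → ℝ}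
    (hequi : ∀ ε > 0, ∃ δ > 0, ∀ u v, |u - v| < δ → ∀ t x, |G t u x - G t v x| < ε)
    (hout : ∀ ε > 0, ∃ R : ℝ, ∀ u, R ≤ |u| → ∀ t x, |G t u x| < ε)
    (hpt : ∀ u, ∀ ε > 0, ∀ᶠ t in l, ∀ x, |G t u x| < ε) {ε : ℝ} (hε : 0 < ε) :
    ∀ᶠ t in l, ∀ u x, |G t u x| < ε := by
  obtain ⟨δ, hδ, h1⟩ := hequi (ε / 2) (half_pos hε)
  obtain ⟨R, hR⟩ := hout ε hε
  -- A finite `δ`-net of `[-R, R]` reduces uniformity in `u` to finitely many pointwise statements.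
  obtain ⟨S, -, hSf, hS⟩ := (isCompact_Icc (a := -R) (b := R)).finite_cover_balls hδ
  filter_upwards [(eventually_all_finite hSf).2 fun v _ => hpt v (ε / 2) (half_pos hε)]
    with t ht u x
  rcases le_total R |u| with hu | hu
  · exact hR u hu t x
  · obtain ⟨v, hv, huv⟩ := Set.mem_iUnion₂.1 (hS (abs_le.1 hu))
    have h2 := h1 u v (by simpa [Real.dist_eq] using huv) t x
    have h3 := ht v hv x
    have h4 := abs_sub_abs_le_abs_sub (G t u x) (G t v x)
    linarith

namespace IsFellerProcess

variable {F : ProcessData d Ω} (hF : IsFellerProcess F)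

include hF

/-- Strong continuity holds for each slice; contractivity of `P_t` passes both the uniform
continuity of `f` in time and its smallness at large times to the semigroup, giving uniformity in
`u`. -/
theorem eventually_abs_semigroup_slice_sub_lt {f : E (d + 1) → ℝ} (hf : IsVanishing f) {ε : ℝ}
    (hε : 0 < ε) :
    ∀ᶠ t in 𝓝[>] (0 : ℝ≥0), ∀ (u : ℝ) (x : E d),
      |semigroup F t (fun y => f (pair u y)) x - f (pair u x)| < ε := by
  refine eventually_forall_abs_lt_of_equicontinuous
    (G := fun t u x => semigroup F t (fun y => f (pair u y)) x - f (pair u x))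
    (fun ε hε => ?_) (fun ε hε => ?_) (fun u ε hε => ?_) hε
  · obtain ⟨δ, hδ, h⟩ := hf.exists_forall_slice_lt (show 0 < ε / 3 by positivity)
    refine ⟨δ, hδ, fun u v huv t x => ?_⟩
    have h1 := hF.isMarkov.abs_semigroup_sub_le t (hf.slice u).isBoundedBorel
      (hf.slice v).isBoundedBorel (by positivity) (fun y => (h u v huv y).le) x
    have h2 := h u v huv x
    rw [abs_lt] at h2 ⊢
    rw [abs_le] at h1
    constructor <;> linarith [h1.1, h1.2, h2.1, h2.2]
  · obtain ⟨R, -, hR⟩ := hf.exists_forall_lt (show 0 < ε / 3 by positivity)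
    refine ⟨R, fun u hu t x => ?_⟩
    have h0 : ∀ y : E d, |f (pair u y)| < ε / 3 := fun y => hR _ (hu.trans (abs_le_norm_pair u y))
    have h1 := abs_semigroup_le hF.isMarkov t (by positivity) (fun y => (h0 y).le) x
    have h2 := h0 x
    rw [abs_lt] at h2 ⊢
    rw [abs_le] at h1
    constructor <;> linarith [h1.1, h1.2, h2.1, h2.2]
  · have h := Metric.tendstoUniformly_iff.1 (hF.strongCont _ (hf.slice u)) ε hε
    filter_upwards [h] with t ht x
    simpa [Real.dist_eq, abs_sub_comm] using ht x

theorem isVanishing_semigroup_spaceTime (t : ℝ≥0) {f : E (d + 1) → ℝ} (hf : IsVanishing f) :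
    IsVanishing (semigroup (spaceTime F) t f) := by
  have := hF.isMarkov.prob
  constructor
  · rw [continuous_iff_continuousAt]
    intro z
    rw [ContinuousAt, Metric.tendsto_nhds]
    intro ε hε
    obtain ⟨δ, hδ, h⟩ := hf.exists_forall_slice_lt (half_pos hε)
    have h1 : ∀ᶠ w in 𝓝 z, |timePart w - timePart z| < δ := by
      simpa [Real.dist_eq] using
        Metric.tendsto_nhds.1 (continuous_timePart.tendsto z) δ hδ
    have h2 := Metric.tendsto_nhds.1 (((hF.maps t _ (hf.slice (timePart z + t))).1.comp
      continuous_spacePart).tendsto z) (ε / 2) (half_pos hε)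
    filter_upwards [h1, h2] with w hw1 hw2
    rw [semigroup_spaceTime, semigroup_spaceTime]
    rw [Real.dist_eq] at hw2 ⊢
    have h3 := hF.isMarkov.abs_semigroup_sub_le t (hf.slice (timePart w + t)).isBoundedBorel
      (hf.slice (timePart z + t)).isBoundedBorel (half_pos hε).le
      (fun y => (h _ _ (by simpa using hw1) y).le) (spacePart w)
    simp only [Function.comp_apply] at hw2
    rw [abs_lt] at hw2 ⊢
    rw [abs_le] at h3
    constructor <;> linarith [h3.1, h3.2, hw2.1, hw2.2]
  · rw [Metric.tendsto_nhds]
    intro ε hε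
    obtain ⟨R, hR0, hR⟩ := hf.exists_forall_lt (show 0 < ε / 3 by positivity)
    obtain ⟨C, hC0, hC⟩ := hf.isBoundedBorel.exists_nonneg_bound
    -- When the shifted time is bounded, `|f_v| ≤ ε/3 + Cχ`, and `P_t χ` vanishes at infinity by the
    -- Feller property of `F`. The denominator `C + 1` below covers `C = 0`.
    obtain ⟨χ, hχ, hχ0, -, hχ1, -⟩ := exists_isTest_cutoff d hR0
    obtain ⟨R', -, hR'⟩ := (hF.maps t χ hχ.isVanishing).exists_forall_lt
      (show 0 < ε / 3 / (C + 1) by positivity)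
    -- The time window is shifted by `-t` because the relevant slice is the one at time `timePart z
    -- + t`.
    have hK : IsCompact ((fun p : ℝ × E d => pair p.1 p.2) ''
        (Set.Icc (-R - t) (R - t) ×ˢ Metric.closedBall 0 R')) :=
      (isCompact_Icc.prod (isCompact_closedBall 0 R')).image continuous_pair
    filter_upwards [hK.compl_mem_cocompact] with z hz
    rw [semigroup_spaceTime, dist_zero_right, Real.norm_eq_abs]
    set v := timePart z + t with hv
    rcases le_or_gt R |v| with hu | hu
    · have h0 : ∀ y : E d, |f (pair v y)| ≤ ε / 3 :=
        fun y => (hR _ (hu.trans (abs_le_norm_pair v y))).le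
      have := abs_semigroup_le hF.isMarkov t (by positivity) h0 (spacePart z)
      linarith
    · have hx : R' ≤ ‖spacePart z‖ := by
        by_contra hlt
        refine hz ⟨(timePart z, spacePart z), ⟨?_, by simpa using (not_le.1 hlt).le⟩,
          pair_timePart_spacePart z⟩
        rw [abs_lt] at hu
        constructor <;> linarith [hu.1, hu.2]
      have hb : ∀ y : E d, |f (pair v y)| ≤ ε / 3 + C * χ y := fun y => by
        rcases le_total ‖y‖ R with hy | hy
        · rw [hχ1 y hy]
          linarith [hC (pair v y)]
        · have := hR _ (hy.trans (norm_le_norm_pair v y))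
          have := mul_nonneg hC0 (hχ0 y)
          linarith
      have h1 := hF.isMarkov.abs_semigroup_le_semigroup t (hf.slice v).isBoundedBorel
        ((isBoundedBorel_const (ε / 3)).add (hχ.isVanishing.isBoundedBorel.const_mul C)) hb
        (spacePart z)
      rw [hF.isMarkov.semigroup_add t (isBoundedBorel_const (ε / 3))
        (hχ.isVanishing.isBoundedBorel.const_mul C), IsMarkovProcess.semigroup_const_mul] at h1
      have h2 := (le_abs_self _).trans (abs_semigroup_le hF.isMarkov t (f := fun _ => ε / 3)
        (C := ε / 3) (by positivity) (fun _ => (abs_of_pos (by positivity)).le) (spacePart z))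
      have h3 := (le_abs_self _).trans (hR' _ hx).le
      have h4 : C * semigroup F t χ (spacePart z) ≤ C * (ε / 3 / (C + 1)) :=
        mul_le_mul_of_nonneg_left h3 hC0
      have h5 : C * (ε / 3 / (C + 1)) ≤ ε / 3 := by
        rw [← mul_div_assoc, div_le_iff₀ (by positivity)]
        nlinarith
      linarith

theorem spaceTime : IsFellerProcess (spaceTime F) := by
  have := hF.isMarkov.prob
  refine ⟨hF.isMarkov.spaceTime, fun t f hf => hF.isVanishing_semigroup_spaceTime t hf,
    fun f hf => Metric.tendstoUniformly_iff.2 fun ε hε => ?_⟩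
  obtain ⟨δ, hδ, h⟩ := hf.exists_forall_slice_lt (half_pos hε)
  have hδ' : ∀ᶠ t : ℝ≥0 in 𝓝[>] 0, (t : ℝ) < δ :=
    nhdsWithin_le_nhds ((NNReal.continuous_coe.tendsto 0).eventually_lt_const (by simpa using hδ))
  filter_upwards [hδ', hF.eventually_abs_semigroup_slice_sub_lt hf (half_pos hε)] with t ht h1 z
  rw [semigroup_spaceTime, dist_comm, Real.dist_eq]
  have h2 := h1 (timePart z + t) (spacePart z)
  have h3 := h (timePart z + t) (timePart z) (by simpa using ht) (spacePart z)
  rw [pair_timePart_spacePart] at h3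
  rw [abs_lt] at h2 h3 ⊢
  constructor <;> linarith [h3.1, h3.2, h2.1, h2.2]

end IsFellerProcess

end Semigroup

/-! ### Generator estimates and the space-time generator -/

section Generator

variable {d : ℕ} {Ω : Type*} [mΩ : MeasurableSpace Ω]

theorem IsMarkovProcess.semigroup_zero {M : ProcessData d Ω} (hM : IsMarkovProcess M)
    (f : E d → ℝ) (x : E d) : semigroup M 0 f x = f x := by
  have := hM.prob x
  have h : (fun ω => extendByZero f (M.X 0 ω)) =ᵐ[M.P x] fun _ => f x := by
    filter_upwards [hM.initial x] with ω hω
    rw [hω, extendByZero_coe]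
  unfold semigroup
  rw [integral_congr_ae h]
  simp

namespace IsGeneratorPair

variable {M : ProcessData d Ω} {f f' g g' : E d → ℝ}

theorem tendsto (h : IsGeneratorPair M f g) (x : E d) :
    Tendsto (fun t : ℝ≥0 => (semigroup M t f x - f x) / (t : ℝ)) (𝓝[>] 0) (𝓝 (g x)) :=
  h.lim.tendsto_at x

theorem eventually_lt (h : IsGeneratorPair M f g) {ε : ℝ} (hε : 0 < ε) :
    ∀ᶠ t in 𝓝[>] (0 : ℝ≥0), ∀ x, |(semigroup M t f x - f x) / (t : ℝ) - g x| < ε := by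
  filter_upwards [Metric.tendstoUniformly_iff.1 h.lim ε hε] with t ht x
  have := ht x
  rwa [dist_comm, Real.dist_eq] at this

theorem sub (hM : IsMarkovProcess M) (h : IsGeneratorPair M f g) (h' : IsGeneratorPair M f' g') :
    IsGeneratorPair M (fun x => f x - f' x) fun x => g x - g' x := by
  refine ⟨h.left.sub h'.left, h.right.sub h'.right, ?_⟩
  refine Eq.mp (congrArg (fun k => TendstoUniformly k _ _) ?_) (h.lim.sub h'.lim)
  funext t x
  simp only [Pi.sub_apply]
  rw [hM.semigroup_sub t h.left h'.left]
  ring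

theorem eq_zero_of_eq_zero (h : IsGeneratorPair M f g) (hf : ∀ x, f x = 0) (x : E d) :
    g x = 0 := by
  refine tendsto_nhds_unique (h.tendsto x) (tendsto_const_nhds.congr fun t => ?_)
  have hs : semigroup M t f x = 0 := by
    rw [show f = fun y => 0 * f y by funext y; simp [hf y], IsMarkovProcess.semigroup_const_mul]
    simp
  rw [hs, hf x]
  simp

/-- Telescoping over `n` steps of length `s`; by contractivity each step costs at most `D`. -/
theorem abs_semigroup_nsmul_sub_le (hM : IsMarkovProcess M) (hf : IsBoundedBorel f) (s : ℝ≥0)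
    {D : ℝ} (hD : 0 ≤ D) (h : ∀ x, |semigroup M s f x - f x| ≤ D) (n : ℕ) (x : E d) :
    |semigroup M (n * s) f x - f x| ≤ n * D := by
  induction n with
  | zero => simp [hM.semigroup_zero]
  | succ n ih =>
    have h1 : semigroup M ((n + 1 : ℕ) * s) f x =
        semigroup M (n * s) (semigroup M s f) x := by
      rw [← hM.semigroup_comp s _ hf]
      congr 1
      push_cast
      ring
    have h2 := hM.abs_semigroup_sub_le (n * s) (hM.isBoundedBorel_semigroup s hf) hf hD h x
    rw [h1]
    rw [abs_le] at ih h2 ⊢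
    push_cast
    constructor <;> linarith [ih.1, ih.2, h2.1, h2.2]

/-- This is the bound that `P_t f - f = ∫₀ᵗ P_s g ds` would give. It is reached without the
integral: for large `n` the step `t/n` has a difference quotient bounded by `C + ε/t`, and
telescoping `n` steps yields `tC + ε`. -/
theorem abs_semigroup_sub_le (hM : IsMarkovProcess M) (h : IsGeneratorPair M f g) {C : ℝ}
    (hC : 0 ≤ C) (hg : ∀ x, |g x| ≤ C) (t : ℝ≥0) (x : E d) :
    |semigroup M t f x - f x| ≤ t * C := by
  rcases eq_or_ne t 0 with rfl | ht
  · simp [hM.semigroup_zero]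
  have ht0 : 0 < t := pos_iff_ne_zero.2 ht
  refine le_of_forall_pos_le_add fun ε hε => ?_
  have hε' : 0 < ε / t := by positivity
  obtain ⟨δ, hδ, hsub⟩ := mem_nhdsGT_iff_exists_Ioo_subset.1 (h.eventually_lt hε')
  obtain ⟨n, hn⟩ := exists_nat_gt (t / δ)
  have hδ0 : 0 < δ := hδ
  have hn0 : (0 : ℝ≥0) < n := lt_of_le_of_lt zero_le hn
  have hs0 : 0 < t / n := by positivity
  have hs : t / n < δ := by
    rw [div_lt_iff₀ hn0]
    rwa [div_lt_iff₀ hδ0, mul_comm] at hn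
  have hsR : (0 : ℝ) < (t / n : ℝ≥0) := hs0
  have hD : ∀ y, |semigroup M (t / n) f y - f y| ≤ (t / n : ℝ≥0) * (C + ε / t) := fun y => by
    have h1 : |(semigroup M (t / n) f y - f y) / ((t / n : ℝ≥0) : ℝ) - g y| < ε / t :=
      hsub ⟨hs0, hs⟩ y
    have h2 := hg y
    have h3 : |(semigroup M (t / n) f y - f y) / ((t / n : ℝ≥0) : ℝ)| ≤ C + ε / t := by
      rw [abs_lt] at h1
      rw [abs_le] at h2 ⊢
      constructor <;> linarith [h1.1, h1.2, h2.1, h2.2]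
    rwa [abs_div, abs_of_pos hsR, div_le_iff₀ hsR, mul_comm] at h3
  have h4 := abs_semigroup_nsmul_sub_le hM h.left (t / n) (by positivity) hD n x
  rw [mul_div_cancel₀ _ hn0.ne'] at h4
  refine h4.trans (le_of_eq ?_)
  have hn0' : (n : ℝ) ≠ 0 := by exact_mod_cast hn0.ne'
  have ht' : (t : ℝ) ≠ 0 := by exact_mod_cast ht
  push_cast
  field_simp

/-- A consequence of the positive maximum principle. -/
theorem abs_le_of_abs_le_mul (hM : IsMarkovProcess M) (h : IsGeneratorPair M f g)
    (h' : IsGeneratorPair M f' g') {c : ℝ} (hff : ∀ x, |f x| ≤ c * f' x) {x : E d}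
    (hx : f' x = 0) : |g x| ≤ c * g' x := by
  have hfx : f x = 0 := abs_nonpos_iff.1 (by simpa [hx] using hff x)
  -- Both functions vanish at `x`, so the difference quotients there are `P_t f(x)/t` and `P_t
  -- f'(x)/t`, which positivity of `P_t` compares. Here `f'` is a second function, not a derivative.
  refine le_of_tendsto_of_tendsto (h.tendsto x).abs ((h'.tendsto x).const_mul c)
    (Eventually.of_forall fun t => ?_)
  have h1 := hM.abs_semigroup_le_semigroup t h.left (h'.left.const_mul c) hff x
  rw [IsMarkovProcess.semigroup_const_mul] at h1
  simp only [hfx, hx, sub_zero]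
  rw [abs_div, NNReal.abs_eq, ← mul_div_assoc]
  exact div_le_div_of_nonneg_right h1 t.2

end IsGeneratorPair

theorem IsBoundedBorel.of_tendstoUniformly {ι : Type*} {l : Filter ι} [l.NeBot]
    [l.IsCountablyGenerated] {f : ι → E d → ℝ} {g : E d → ℝ} (hf : ∀ i, IsBoundedBorel (f i))
    (h : TendstoUniformly f g l) : IsBoundedBorel g := by
  refine ⟨measurable_of_tendsto_metrizable' l (fun i => (hf i).1)
    (tendsto_pi_nhds.2 h.tendsto_at), ?_⟩
  obtain ⟨i, hi⟩ := (Metric.tendstoUniformly_iff.1 h 1 one_pos).exists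
  obtain ⟨C, hC⟩ := (hf i).2
  refine ⟨C + 1, fun x => ?_⟩
  have h1 := hi x
  have h2 := hC x
  have h3 := abs_sub_abs_le_abs_sub (g x) (f i x)
  rw [Real.dist_eq] at h1
  linarith

/-- The generator of the space-time process is `∂_u + A`. -/
theorem IsFellerProcess.isGeneratorPair_spaceTime {F : ProcessData d Ω} (hF : IsFellerProcess F)
    {f f' : E (d + 1) → ℝ} (hf : IsVanishing f) (hf' : IsVanishing f')
    (hderiv : ∀ (u : ℝ) (x : E d), HasDerivAt (fun v => f (pair v x)) (f' (pair u x)) u)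
    {R : ℝ} (hR : ∀ (u : ℝ) (x : E d), R ≤ |u| → f (pair u x) = 0)
    {g : ℝ → E d → ℝ} (hg : ∀ u, IsGeneratorPair F (fun x => f (pair u x)) (g u))
    {L : ℝ} (hL : 0 ≤ L) (hgL : ∀ u v x, |g u x - g v x| ≤ L * |u - v|) :
    IsGeneratorPair (LevyType.spaceTime F) f fun z => f' z + g (timePart z) (spacePart z) := by
  have := hF.isMarkov.prob
  have hM := hF.isMarkov
  have huniform : ∀ ε > 0, ∀ᶠ t in 𝓝[>] (0 : ℝ≥0), ∀ (u : ℝ) (x : E d),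
      |(semigroup F t (fun y => f (pair u y)) x - f (pair u x)) / (t : ℝ) - g u x| < ε := by
    intro ε hε
    refine eventually_forall_abs_lt_of_equicontinuous (G := fun (t : ℝ≥0) u x =>
      (semigroup F t (fun y => f (pair u y)) x - f (pair u x)) / (t : ℝ) - g u x)
      (fun ε hε => ?_) (fun ε hε => ?_) (fun u ε hε => (hg u).eventually_lt hε) hε
    -- Both the quotient of `f_u - f_v` and its generator are at most `L|u - v|`, hence the factor
    -- `2`; `L + 1` keeps the denominator positive.
    · refine ⟨ε / (2 * (L + 1)), by positivity, fun u v huv t x => ?_⟩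
      have h1 := ((hg u).sub hM (hg v)).abs_semigroup_sub_le hM (by positivity)
        (fun x => hgL u v x) t x
      rw [hM.semigroup_sub t (hg u).left (hg v).left] at h1
      have h2 : |(semigroup F t (fun y => f (pair u y)) x - semigroup F t (fun y => f (pair v y)) x
          - (f (pair u x) - f (pair v x))) / (t : ℝ)| ≤ L * |u - v| := by
        rw [abs_div, NNReal.abs_eq]
        exact div_le_of_le_mul₀ t.2 (by positivity) (by rwa [mul_comm])
      have h3 := hgL u v x
      have h4 : 2 * (L * |u - v|) < ε := by
        rw [lt_div_iff₀ (by positivity)] at huv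
        nlinarith [abs_nonneg (u - v)]
      have h5 : (semigroup F t (fun y => f (pair u y)) x - f (pair u x)) / (t : ℝ) - g u x -
          ((semigroup F t (fun y => f (pair v y)) x - f (pair v x)) / (t : ℝ) - g v x) =
          (semigroup F t (fun y => f (pair u y)) x - semigroup F t (fun y => f (pair v y)) x
          - (f (pair u x) - f (pair v x))) / (t : ℝ) - (g u x - g v x) := by ring
      rw [h5]
      have h6 := abs_sub (((semigroup F t (fun y => f (pair u y)) x -
        semigroup F t (fun y => f (pair v y)) x - (f (pair u x) - f (pair v x))) / (t : ℝ)))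
        (g u x - g v x)
      linarith
    · refine ⟨R, fun u hu t x => ?_⟩
      have h0 : (fun y : E d => f (pair u y)) = fun y => 0 * f (pair u y) := by
        funext y
        simp [hR u y hu]
      rw [(hg u).eq_zero_of_eq_zero (fun y => hR u y hu) x, h0,
        IsMarkovProcess.semigroup_const_mul, hR u x hu]
      simpa using hε
  have hlim : TendstoUniformly
      (fun (t : ℝ≥0) z => (semigroup (LevyType.spaceTime F) t f z - f z) / (t : ℝ))
      (fun z => f' z + g (timePart z) (spacePart z)) (𝓝[>] 0) := by
    refine Metric.tendstoUniformly_iff.2 fun ε hε => ?_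
    obtain ⟨δ, hδ, hδf⟩ := hf'.exists_forall_slice_lt (show 0 < ε / 3 by positivity)
    have hδ' : ∀ᶠ t : ℝ≥0 in 𝓝[>] 0, (t : ℝ) < δ :=
      nhdsWithin_le_nhds
        ((NNReal.continuous_coe.tendsto 0).eventually_lt_const (by simpa using hδ))
    filter_upwards [hδ', self_mem_nhdsWithin, huniform (ε / 3) (by positivity),
      hF.eventually_abs_semigroup_slice_sub_lt hf' (show 0 < ε / 3 by positivity)]
      with t ht ht0 h1 h2 z
    have ht0' : (0 : ℝ) < t := ht0
    rw [semigroup_spaceTime, dist_comm, Real.dist_eq]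
    set u := timePart z
    set x := spacePart z
    have hz : z = pair u x := (pair_timePart_spacePart z).symm
    rw [hz]
    -- The time quotient equals `f'` at an intermediate time, within `δ` of `u`. The total error has
    -- three parts of size `ε/3`: this one after applying `P_t`, the passage from `P_t f'_u` to
    -- `f'_u`, and the quotient of the fixed slice.
    have hq : ∀ y : E d, |(t : ℝ)⁻¹ * (f (pair (u + t) y) - f (pair u y)) - f' (pair u y)| ≤
        ε / 3 := fun y => by
      obtain ⟨c, hc, hcs⟩ := exists_hasDerivAt_eq_slope (fun v => f (pair v y))
        (fun v => f' (pair v y)) (show u < u + t by linarith)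
        (fun v _ => (hderiv v y).continuousAt.continuousWithinAt) (fun v _ => hderiv v y)
      have h3 := hδf c u (by rw [abs_lt]; constructor <;> linarith [hc.1, hc.2]) y
      rw [hcs, add_sub_cancel_left, div_eq_inv_mul] at h3
      exact h3.le
    have hqb := (((hf.slice (u + t)).isBoundedBorel.sub
      (hf.slice u).isBoundedBorel).const_mul (t : ℝ)⁻¹)
    have h3 := hM.abs_semigroup_sub_le t hqb (hf'.slice u).isBoundedBorel (by positivity) hq x
    rw [IsMarkovProcess.semigroup_const_mul, hM.semigroup_sub t (hf.slice (u + t)).isBoundedBorel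
      (hf.slice u).isBoundedBorel] at h3
    have h4 := h1 u x
    have h5 := h2 u x
    have h6 : (semigroup F t (fun y => f (pair (u + t) y)) x - f (pair u x)) / (t : ℝ) =
        (t : ℝ)⁻¹ * (semigroup F t (fun y => f (pair (u + t) y)) x -
          semigroup F t (fun y => f (pair u y)) x) +
        (semigroup F t (fun y => f (pair u y)) x - f (pair u x)) / (t : ℝ) := by
      field_simp
      ring
    rw [h6]
    rw [abs_le] at h3
    rw [abs_lt] at h4 h5 ⊢
    constructor <;> linarith [h3.1, h3.2, h4.1, h4.2, h5.1, h5.2]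
  -- No measurability of `g` in `u` is assumed; the limit is Borel and bounded as a uniform limit of
  -- bounded Borel quotients.
  refine ⟨hf.isBoundedBorel, IsBoundedBorel.of_tendstoUniformly (fun t => ?_) hlim, hlim⟩
  have h := ((hM.isBoundedBorel_semigroup_spaceTime t hf.isBoundedBorel).sub
    hf.isBoundedBorel).const_mul (t : ℝ)⁻¹
  simpa only [div_eq_inv_mul] using h

end Generator

/-! ### Growth of negative definite symbols -/

section Symbol

variable {d : ℕ}

namespace IsNegativeDefinite

variable {ψ : E d → ℂ} (hψ : IsNegativeDefinite ψ)

include hψ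

theorem apply_zero_nonneg : 0 ≤ ψ 0 := by
  have h := (hψ 1 (fun _ => 0)).diag_nonneg (i := 0)
  simp only [Matrix.of_apply, sub_zero, add_sub_cancel_left] at h
  exact (star_nonneg_iff (x := ψ 0)).1 h

theorem apply_add_star_sub_nonneg (ξ : E d) : 0 ≤ ψ ξ + star (ψ ξ) - ψ 0 := by
  have h := (hψ 1 (fun _ => ξ)).diag_nonneg (i := 0)
  simpa only [Matrix.of_apply, sub_self] using h

theorem star_apply_sub (ξ η : E d) : star (ψ (η - ξ)) = ψ (ξ - η) := by
  have h := (hψ 2 ![ξ, η]).isHermitian.apply 0 1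
  simp only [Matrix.of_apply, Matrix.cons_val_zero, Matrix.cons_val_one, star_sub, star_add,
    star_star] at h
  rw [add_comm] at h
  exact sub_right_injective h

theorem norm_neg (ξ : E d) : ‖ψ (-ξ)‖ = ‖ψ ξ‖ := by
  have h := hψ.star_apply_sub 0 ξ
  rw [sub_zero, zero_sub] at h
  rw [← h, norm_star]

/-- The `2 × 2` matrix at `ξ, η` has nonnegative determinant, and its diagonal entries are at most
`2‖ψ ξ‖` and `2‖ψ η‖` because `ψ 0 ≥ 0`. -/
theorem norm_sq_le (ξ η : E d) :
    ‖ψ ξ + star (ψ η) - ψ (ξ - η)‖ ^ 2 ≤ 4 * ‖ψ ξ‖ * ‖ψ η‖ := by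
  set z := ψ ξ + star (ψ η) - ψ (ξ - η) with hz
  have h := (hψ 2 ![ξ, η]).det_nonneg
  have h0 := Complex.nonneg_iff.1 hψ.apply_zero_nonneg
  have h1 := Complex.nonneg_iff.1 (hψ.apply_add_star_sub_nonneg ξ)
  have h2 := Complex.nonneg_iff.1 (hψ.apply_add_star_sub_nonneg η)
  rw [Matrix.det_fin_two] at h
  simp only [Matrix.of_apply, Matrix.cons_val_zero, Matrix.cons_val_one, sub_self] at h
  have hw : ψ η + star (ψ ξ) - ψ (η - ξ) = star z := by
    rw [hz, star_sub, star_add, star_star, hψ.star_apply_sub η ξ]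
    ring
  rw [hw, ← hz] at h
  have h3 := (Complex.nonneg_iff.1 h).1
  have h4 : (z * star z).re = ‖z‖ ^ 2 := by
    rw [Complex.star_def, Complex.mul_conj, Complex.ofReal_re, Complex.normSq_eq_norm_sq]
  rw [Complex.sub_re, h4, Complex.mul_re, ← h1.2, ← h2.2] at h3
  have h5 : (ψ ξ + star (ψ ξ) - ψ 0).re ≤ 2 * ‖ψ ξ‖ := by
    have := Complex.re_le_norm (ψ ξ)
    simp only [Complex.sub_re, Complex.add_re, Complex.star_def, Complex.conj_re]
    linarith [h0.1]
  have h6 : (ψ η + star (ψ η) - ψ 0).re ≤ 2 * ‖ψ η‖ := by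
    have := Complex.re_le_norm (ψ η)
    simp only [Complex.sub_re, Complex.add_re, Complex.star_def, Complex.conj_re]
    linarith [h0.1]
  have h7 := mul_le_mul h5 h6 h2.1 (by positivity)
  linarith

/-- By `norm_sq_le` the cross term is at most `2√‖ψ ξ‖√‖ψ η‖`, which completes the square. -/
theorem sqrt_norm_sub_le (ξ η : E d) : √‖ψ (ξ - η)‖ ≤ √‖ψ ξ‖ + √‖ψ η‖ := by
  have h := hψ.norm_sq_le ξ η
  have hs : ‖ψ ξ + star (ψ η) - ψ (ξ - η)‖ ≤ 2 * √‖ψ ξ‖ * √‖ψ η‖ := by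
    refine le_of_sq_le_sq (h.trans (le_of_eq ?_)) (by positivity)
    rw [mul_pow, mul_pow, Real.sq_sqrt (norm_nonneg _), Real.sq_sqrt (norm_nonneg _)]
    norm_num
  have h1 : ‖ψ (ξ - η)‖ ≤ ‖ψ ξ‖ + ‖ψ η‖ + ‖ψ ξ + star (ψ η) - ψ (ξ - η)‖ := by
    calc ‖ψ (ξ - η)‖ = ‖(ψ ξ + star (ψ η)) - (ψ ξ + star (ψ η) - ψ (ξ - η))‖ := by
          congr 1; ring
      _ ≤ ‖ψ ξ + star (ψ η)‖ + ‖ψ ξ + star (ψ η) - ψ (ξ - η)‖ := norm_sub_le _ _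
      _ ≤ _ := by
          gcongr
          exact (norm_add_le _ _).trans (by rw [norm_star])
  refine Real.sqrt_le_iff.2 ⟨by positivity, ?_⟩
  have h2 := Real.sq_sqrt (norm_nonneg (ψ ξ))
  have h3 := Real.sq_sqrt (norm_nonneg (ψ η))
  nlinarith

theorem sqrt_norm_nsmul_le (ξ : E d) (n : ℕ) :
    √‖ψ (((n + 1 : ℕ) : ℝ) • ξ)‖ ≤ ((n + 1 : ℕ) : ℝ) * √‖ψ ξ‖ := by
  induction n with
  | zero => simp
  | succ n ih =>
    have h := hψ.sqrt_norm_sub_le (((n + 1 : ℕ) : ℝ) • ξ) (-ξ)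
    rw [hψ.norm_neg, sub_neg_eq_add] at h
    have h1 : ((n + 1 + 1 : ℕ) : ℝ) • ξ = ((n + 1 : ℕ) : ℝ) • ξ + ξ := by
      rw [Nat.cast_succ (n + 1), add_smul, one_smul]
    rw [h1, Nat.cast_succ (n + 1), add_mul, one_mul]
    linarith

/-- Subadditivity of `√‖ψ‖` along `n + 1` copies of `ξ/(n+1)`, a point of the unit ball, gives the
factor `(‖ξ‖ + 2)²`, which is at most `8(1 + ‖ξ‖²)`. -/
theorem norm_le_of_forall_norm_le_one {S : ℝ} (hS : ∀ ξ : E d, ‖ξ‖ ≤ 1 → ‖ψ ξ‖ ≤ S) (ξ : E d) :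
    ‖ψ ξ‖ ≤ 8 * S * (1 + ‖ξ‖ ^ 2) := by
  obtain ⟨n, hn, hn'⟩ : ∃ n : ℕ, ‖ξ‖ ≤ (n + 1 : ℕ) ∧ ((n + 1 : ℕ) : ℝ) ≤ ‖ξ‖ + 2 := by
    refine ⟨⌈‖ξ‖⌉₊, ?_, ?_⟩
    · push_cast
      linarith [Nat.le_ceil ‖ξ‖]
    · push_cast
      linarith [Nat.ceil_lt_add_one (norm_nonneg ξ)]
  have hpos : (0 : ℝ) < (n + 1 : ℕ) := by positivity
  have hS0 : 0 ≤ S := (norm_nonneg _).trans (hS 0 (by simp))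
  have h := hψ.sqrt_norm_nsmul_le (((n + 1 : ℕ) : ℝ)⁻¹ • ξ) n
  rw [smul_inv_smul₀ hpos.ne'] at h
  have h1 : ‖ψ (((n + 1 : ℕ) : ℝ)⁻¹ • ξ)‖ ≤ S := by
    refine hS _ ?_
    rw [norm_smul, norm_inv, Real.norm_of_nonneg hpos.le, inv_mul_le_iff₀ hpos, mul_one]
    exact hn
  have h2 : √‖ψ ξ‖ ≤ (‖ξ‖ + 2) * √S :=
    h.trans (mul_le_mul hn' (Real.sqrt_le_sqrt h1) (Real.sqrt_nonneg _) (by positivity))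
  have h3 := pow_le_pow_left₀ (Real.sqrt_nonneg _) h2 2
  rw [Real.sq_sqrt (norm_nonneg _), mul_pow, Real.sq_sqrt hS0] at h3
  nlinarith [mul_nonneg hS0 (sq_nonneg (‖ξ‖ - 2)), mul_nonneg hS0 (sq_nonneg ‖ξ‖)]

end IsNegativeDefinite

theorem IsNegativeDefiniteSymbol.exists_norm_le {q : E d → E d → ℂ}
    (hq : IsNegativeDefiniteSymbol q) {K : Set (E d)} (hK : IsCompact K) :
    ∃ C : ℝ, 0 ≤ C ∧ ∀ x ∈ K, ∀ ξ, ‖q x ξ‖ ≤ C * (1 + ‖ξ‖ ^ 2) := by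
  obtain ⟨S, hS⟩ := hq.locallyBounded _ (hK.prod (isCompact_closedBall (0 : E d) 1))
  refine ⟨8 * max S 0, by positivity, fun x hx ξ => ?_⟩
  refine (hq.negDef x).norm_le_of_forall_norm_le_one (fun η hη => ?_) ξ
  exact (hS (x, η) ⟨hx, by simpa using hη⟩).trans (le_max_left _ _)

theorem spacePart_sub (z w : E (d + 1)) : spacePart (z - w) = spacePart z - spacePart w := rfl

theorem timePart_sub (z w : E (d + 1)) : timePart (z - w) = timePart z - timePart w := rfl

theorem IsNegativeDefiniteSymbol.spaceTime {q : E d → E d → ℂ} (hq : IsNegativeDefiniteSymbol q) :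
    IsNegativeDefiniteSymbol fun z w : E (d + 1) =>
      -Complex.I * (timePart w : ℂ) + q (spacePart z) (spacePart w) := by
  have ht : Continuous fun w : E (d + 1) => -Complex.I * (timePart w : ℂ) :=
    continuous_const.mul (Complex.continuous_ofReal.comp continuous_timePart)
  refine ⟨?_, fun K hK => ?_, fun z => ?_, fun z n ξ => ?_⟩
  · exact (ht.measurable.comp measurable_snd).add (hq.measurable.comp
      ((continuous_spacePart.measurable.comp measurable_fst).prodMk
        (continuous_spacePart.measurable.comp measurable_snd)))
  · obtain ⟨C, hC⟩ := hq.locallyBounded _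
      (hK.image (continuous_spacePart.prodMap continuous_spacePart))
    obtain ⟨D, hD⟩ := hK.exists_bound_of_continuousOn (ht.comp continuous_snd).continuousOn
    exact ⟨D + C, fun p hp => (norm_add_le _ _).trans
      (add_le_add (hD p hp) (hC _ ⟨p, hp, rfl⟩))⟩
  · exact ht.add ((hq.continuous _).comp continuous_spacePart)
  -- The term `-iζ` is additive and purely imaginary, so it cancels from the matrix.
  · convert hq.negDef (spacePart z) n (fun j => spacePart (ξ j)) using 1
    ext j k
    simp only [Matrix.of_apply, spacePart_sub, timePart_sub, Complex.ofReal_sub, Complex.star_def,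
      map_add, map_mul, map_neg, Complex.conj_I, Complex.conj_ofReal]
    ring

end Symbol

/-! ### Fourier transform of test functions -/

section FourierTransform

open scoped FourierTransform SchwartzMap LineDeriv ContDiff

variable {d : ℕ} {f : E d → ℝ}

/-- A test function as a complex-valued Schwartz function. -/
def IsTest.toSchwartz (hf : IsTest f) : 𝓢(E d, ℂ) :=
  (hf.2.comp_left (g := Complex.ofReal) Complex.ofReal_zero).toSchwartzMap
    (Complex.ofRealCLM.contDiff.comp hf.1)

theorem IsTest.toSchwartz_apply (hf : IsTest f) (x : E d) : hf.toSchwartz x = (f x : ℂ) := rfl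

theorem IsTest.fourier_eq (hf : IsTest f) (ξ : E d) :
    fourier f ξ = (((2 * Real.pi) ^ d)⁻¹ : ℝ) * 𝓕 hf.toSchwartz ((2 * Real.pi)⁻¹ • ξ) := by
  rw [SchwartzMap.fourier_coe, Real.fourier_eq', fourier]
  congr 1
  refine integral_congr_ae (Eventually.of_forall fun x => ?_)
  simp only [smul_eq_mul, hf.toSchwartz_apply]
  congr 2
  rw [inner_smul_right, real_inner_comm]
  have : (Real.pi : ℂ) ≠ 0 := Complex.ofReal_ne_zero.2 Real.pi_ne_zero
  push_cast
  field_simp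

theorem IsTest.continuous_fourier (hf : IsTest f) : Continuous (fourier f) := by
  rw [funext hf.fourier_eq]
  exact continuous_const.mul ((𝓕 hf.toSchwartz).continuous.comp (continuous_const_smul _))

theorem IsTest.integrable_pow_mul_fourier (hf : IsTest f) (k : ℕ) :
    Integrable fun ξ : E d => ‖ξ‖ ^ k * ‖fourier f ξ‖ := by
  have hpi : (0 : ℝ) < 2 * Real.pi := by positivity
  have h := (((𝓕 hf.toSchwartz).integrable_pow_mul volume k).comp_smul
    (inv_ne_zero hpi.ne')).const_mul ((2 * Real.pi) ^ k * ((2 * Real.pi) ^ d)⁻¹)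
  refine h.congr (Eventually.of_forall fun ξ => ?_)
  simp only
  rw [hf.fourier_eq, norm_mul, Complex.norm_real, Real.norm_of_nonneg (by positivity), norm_smul,
    norm_inv, Real.norm_of_nonneg hpi.le, mul_pow _ ‖ξ‖, inv_pow]
  field_simp

theorem IsTest.exists_pow_mul_fourier_le (hf : IsTest f) (k : ℕ) :
    ∃ C : ℝ, ∀ ξ : E d, ‖ξ‖ ^ k * ‖fourier f ξ‖ ≤ C := by
  have hpi : (0 : ℝ) < 2 * Real.pi := by positivity
  obtain ⟨C, -, hC⟩ := (𝓕 hf.toSchwartz).decay k 0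
  refine ⟨(2 * Real.pi) ^ k * ((2 * Real.pi) ^ d)⁻¹ * C, fun ξ => ?_⟩
  have h := mul_le_mul_of_nonneg_left (hC ((2 * Real.pi)⁻¹ • ξ))
    (show 0 ≤ (2 * Real.pi) ^ k * ((2 * Real.pi) ^ d)⁻¹ by positivity)
  refine (le_of_eq ?_).trans h
  rw [hf.fourier_eq, norm_mul, Complex.norm_real, Real.norm_of_nonneg (by positivity), norm_smul,
    norm_inv, Real.norm_of_nonneg hpi.le, mul_pow _ ‖ξ‖, inv_pow, norm_iteratedFDeriv_zero]
  field_simp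

/-- Fourier inversion. -/
theorem IsTest.integral_exp_mul_fourier (hf : IsTest f) (x : E d) :
    ∫ ξ : E d, Complex.exp (Complex.I * (inner ℝ ξ x : ℝ)) * fourier f ξ = f x := by
  have hpi : (0 : ℝ) < 2 * Real.pi := by positivity
  have h1 : 𝓕⁻ (𝓕 hf.toSchwartz) x = hf.toSchwartz x := by simp
  rw [SchwartzMap.fourierInv_coe, Real.fourierInv_eq', hf.toSchwartz_apply] at h1
  have h2 := Measure.integral_comp_smul (volume : Measure (E d)) (fun v =>
    Complex.exp (((2 * Real.pi * inner ℝ v x : ℝ) : ℂ) * Complex.I) • 𝓕 hf.toSchwartz v)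
    (2 * Real.pi)⁻¹
  rw [h1, finrank_euclideanSpace_fin, inv_pow, inv_inv, abs_of_nonneg (by positivity)] at h2
  have h3 : ∀ ξ : E d, Complex.exp (Complex.I * (inner ℝ ξ x : ℝ)) * fourier f ξ =
      (((2 * Real.pi) ^ d)⁻¹ : ℝ) *
        (Complex.exp (((2 * Real.pi * inner ℝ ((2 * Real.pi)⁻¹ • ξ) x : ℝ) : ℂ) * Complex.I) •
          𝓕 hf.toSchwartz ((2 * Real.pi)⁻¹ • ξ)) := fun ξ => by
    rw [hf.fourier_eq, real_inner_smul_left, mul_inv_cancel_left₀ hpi.ne', smul_eq_mul,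
      mul_comm Complex.I]
    ring
  simp only [h3]
  rw [integral_const_mul, h2, Complex.real_smul, ← mul_assoc, ← Complex.ofReal_mul,
    inv_mul_cancel₀ (by positivity), Complex.ofReal_one, one_mul]

theorem IsTest.fderiv_apply (hf : IsTest f) (m : E d) : IsTest fun x => fderiv ℝ f x m :=
  ⟨(hf.1.fderiv_right (m := ∞) (by simp)).clm_apply contDiff_const, hf.2.fderiv_apply ℝ m⟩

theorem IsTest.fourier_fderiv_apply (hf : IsTest f) (m ξ : E d) :
    fourier (fun x => fderiv ℝ f x m) ξ = Complex.I * (inner ℝ ξ m : ℝ) * fourier f ξ := by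
  have h : (hf.fderiv_apply m).toSchwartz = ∂_{m} hf.toSchwartz := by
    ext x
    rw [SchwartzMap.lineDerivOp_apply_eq_fderiv, IsTest.toSchwartz_apply]
    have h1 : HasFDerivAt (fun y => (f y : ℂ)) (Complex.ofRealCLM.comp (fderiv ℝ f x)) x :=
      Complex.ofRealCLM.hasFDerivAt.comp x
        (hf.1.differentiable (by simp)).differentiableAt.hasFDerivAt
    change _ = fderiv ℝ (fun y => (f y : ℂ)) x m
    rw [h1.fderiv]
    rfl
  have hpi : (Real.pi : ℂ) ≠ 0 := Complex.ofReal_ne_zero.2 Real.pi_ne_zero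
  have hg : (fun x : E d => inner ℝ x m).HasTemperateGrowth := by fun_prop
  rw [(hf.fderiv_apply m).fourier_eq, h, SchwartzMap.fourier_lineDerivOp_eq, hf.fourier_eq]
  rw [smul_apply, SchwartzMap.smulLeftCLM_apply_apply hg, real_inner_smul_left,
    Complex.real_smul, smul_eq_mul]
  push_cast
  field_simp

end FourierTransform

/-! ### Partial Fourier transform of time slices -/

section FourierSlice

open scoped FourierTransform ContDiff

variable {d : ℕ} {f : E (d + 1) → ℝ}

theorem IsTest.exists_radius {d : ℕ} {f : E d → ℝ} (hf : IsTest f) :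
    ∃ R : ℝ, 0 < R ∧ ∀ x, R ≤ ‖x‖ → f x = 0 := by
  obtain ⟨R, hR⟩ := hf.2.isBounded.exists_norm_le
  refine ⟨max R 0 + 1, by positivity, fun x hx => ?_⟩
  by_contra hne
  have h1 := hR x (subset_tsupport f hne)
  linarith [le_max_left R 0]

theorem contDiff_pair_right (u : ℝ) : ContDiff ℝ ∞ fun x : E d => pair u x := by
  have h : ∀ x : E d, pair u x =
      (LinearMap.toContinuousLinearMap (IsLinearMap.mk' (fun x : E d => pair 0 x)
        ⟨fun x y => by rw [← pair_add, add_zero], fun c x => by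
          rw [← pair_smul, mul_zero]⟩)) x + pair u 0 := fun x => by
    change pair u x = pair 0 x + pair u 0
    rw [← pair_add]
    simp
  rw [funext h]
  exact (ContinuousLinearMap.contDiff _).add contDiff_const

theorem IsTest.slice (hf : IsTest f) (u : ℝ) : IsTest fun x : E d => f (pair u x) := by
  obtain ⟨R, -, hR⟩ := hf.exists_radius
  refine ⟨hf.1.comp (contDiff_pair_right u),
    HasCompactSupport.intro (isCompact_closedBall (0 : E d) R) fun x hx => hR _ ?_⟩
  rw [mem_closedBall_zero_iff, not_le] at hx
  exact hx.le.trans (norm_le_norm_pair u x)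

theorem IsTest.hasDerivAt_slice (hf : IsTest f) (u : ℝ) (x : E d) :
    HasDerivAt (fun v => f (pair v x)) (fderiv ℝ f (pair u x) (pair 1 0)) u := by
  have h1 : HasDerivAt (fun v => pair v x) (pair 1 (0 : E d)) u := by
    have h2 := ((hasDerivAt_id u).smul_const (pair 1 (0 : E d))).const_add (pair 0 x)
    rw [one_smul] at h2
    refine h2.congr_of_eventuallyEq (Eventually.of_forall fun v => ?_)
    simpa using pair_eq_add_smul v 0 x
  exact ((hf.1.differentiable (by simp)).differentiableAt.hasFDerivAt).comp_hasDerivAt u h1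

theorem IsTest.integrable_pair (hf : IsTest f) (k : ℕ) :
    Integrable fun p : ℝ × E d => ‖pair p.1 p.2‖ ^ k * ‖fourier f (pair p.1 p.2)‖ :=
  (measurePreserving_pair.integrable_comp_emb measurableEmbedding_pair).2
    (hf.integrable_pow_mul_fourier k)

theorem IsTest.continuous_fourier_pair (hf : IsTest f) :
    Continuous fun p : ℝ × E d => fourier f (pair p.1 p.2) :=
  hf.continuous_fourier.comp continuous_pair

/-- Decay of orders `k` and `k + 2` in the full frequency gives the majorant `(C + D)/(1 + ζ²)`. -/
theorem IsTest.integrable_abs_pow_mul_fourier_pair (hf : IsTest f) (k : ℕ) (ξ : E d) :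
    Integrable fun ζ : ℝ => |ζ| ^ k * ‖fourier f (pair ζ ξ)‖ := by
  obtain ⟨C, hC⟩ := hf.exists_pow_mul_fourier_le k
  obtain ⟨D, hD⟩ := hf.exists_pow_mul_fourier_le (k + 2)
  have hc : Continuous fun ζ : ℝ => fourier f (pair ζ ξ) :=
    hf.continuous_fourier.comp (continuous_pair_left ξ)
  refine (integrable_inv_one_add_sq.const_mul (C + D)).mono'
    (((continuous_abs.pow k).mul hc.norm).aestronglyMeasurable)
    (Eventually.of_forall fun ζ => ?_)
  rw [Real.norm_of_nonneg (by positivity), ← div_eq_mul_inv, le_div_iff₀ (by positivity)]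
  have h1 : |ζ| ^ k * ‖fourier f (pair ζ ξ)‖ ≤ C := le_trans
    (by gcongr; exact abs_le_norm_pair ζ ξ) (hC (pair ζ ξ))
  have h2 : |ζ| ^ (k + 2) * ‖fourier f (pair ζ ξ)‖ ≤ D := le_trans
    (by gcongr; exact abs_le_norm_pair ζ ξ) (hD (pair ζ ξ))
  rw [pow_add, sq_abs] at h2
  linarith

theorem IsTest.integrable_fourier_pair (hf : IsTest f) (ξ : E d) :
    Integrable fun ζ : ℝ => fourier f (pair ζ ξ) := by
  refine (hf.integrable_abs_pow_mul_fourier_pair 0 ξ).mono'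
    (hf.continuous_fourier.comp (continuous_pair_left ξ)).aestronglyMeasurable
    (Eventually.of_forall fun ζ => by simp)

theorem integrable_exp_mul {α : Type*} [MeasurableSpace α] {μ : Measure α} {φ : α → ℝ}
    {g : α → ℂ} (hg : Integrable g μ) (hφ : AEStronglyMeasurable φ μ) :
    Integrable (fun x => Complex.exp (Complex.I * (φ x : ℝ)) * g x) μ :=
  hg.bdd_mul (c := 1) (Complex.continuous_exp.comp_aestronglyMeasurable
    ((Complex.continuous_ofReal.comp_aestronglyMeasurable hφ).const_mul _))
    (Eventually.of_forall fun _ => (Complex.norm_exp_I_mul_ofReal _).le)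

theorem IsTest.continuous_fourier_slice (hf : IsTest f) (ξ : E d) :
    Continuous fun u => fourier (fun x : E d => f (pair u x)) ξ := by
  obtain ⟨R, -, hR⟩ := hf.exists_radius
  refine continuous_const.mul ?_
  rw [← continuousOn_univ]
  refine continuousOn_integral_of_compact_support (isCompact_closedBall (0 : E d) R)
    (Continuous.continuousOn ?_) fun u x _ hx => ?_
  · refine Continuous.mul (by fun_prop) (Complex.continuous_ofReal.comp ?_)
    exact hf.1.continuous.comp continuous_pair
  · rw [mem_closedBall_zero_iff, not_le] at hx
    simp [hR _ (hx.le.trans (norm_le_norm_pair u x))]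

theorem IsTest.integrable_exp_mul_pair (hf : IsTest f) (ξ : E d) :
    Integrable fun p : ℝ × E d =>
      Complex.exp (-Complex.I * (inner ℝ ξ p.2 : ℝ)) * (f (pair p.1 p.2) : ℂ) := by
  have h1 : Integrable fun p : ℝ × E d => (f (pair p.1 p.2) : ℂ) :=
    ((measurePreserving_pair.integrable_comp_emb measurableEmbedding_pair).2
      (hf.1.continuous.integrable_of_hasCompactSupport hf.2)).ofReal
  have h2 := integrable_exp_mul (φ := fun p : ℝ × E d => -inner ℝ ξ p.2) h1
    (by fun_prop : Continuous fun p : ℝ × E d => -inner ℝ ξ p.2).aestronglyMeasurable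
  simpa using h2

/-- Fubini: transforming first in space and then in time is the full transform. The factor `2π` and
the rescaled frequency reconcile the two normalisations. -/
theorem IsTest.fourier_fourier_slice (hf : IsTest f) (ξ : E d) (s : ℝ) :
    𝓕 (fun u => fourier (fun x : E d => f (pair u x)) ξ) s =
      (2 * Real.pi : ℝ) * fourier f (pair (2 * Real.pi * s) ξ) := by
  have hpi : (0 : ℝ) < 2 * Real.pi := by positivity
  have hint := integrable_exp_mul (φ := fun p : ℝ × E d => -(2 * Real.pi * s * p.1))
    (hf.integrable_exp_mul_pair ξ)
    (by fun_prop : Continuous fun p : ℝ × E d => -(2 * Real.pi * s * p.1)).aestronglyMeasurable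
  have h1 : ∫ p : ℝ × E d, Complex.exp (Complex.I * ((-(2 * Real.pi * s * p.1) : ℝ) : ℂ)) *
      (Complex.exp (-Complex.I * (inner ℝ ξ p.2 : ℝ)) * (f (pair p.1 p.2) : ℂ)) =
      ∫ z : E (d + 1), Complex.exp (-Complex.I * (inner ℝ (pair (2 * Real.pi * s) ξ) z : ℝ)) *
        (f z : ℂ) := by
    rw [← measurePreserving_pair.integral_comp measurableEmbedding_pair]
    refine integral_congr_ae (Eventually.of_forall fun p => ?_)
    simp only
    rw [inner_pair, ← mul_assoc, ← Complex.exp_add]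
    congr 2
    push_cast
    ring
  rw [Measure.volume_eq_prod, integral_prod _ hint] at h1
  rw [Real.fourier_real_eq_integral_exp_smul]
  unfold fourier
  rw [← h1, ← integral_const_mul, ← integral_const_mul]
  refine integral_congr_ae (Eventually.of_forall fun u => ?_)
  simp only [smul_eq_mul]
  rw [integral_const_mul, pow_succ]
  have hc : Complex.exp (((-2 * Real.pi * u * s : ℝ) : ℂ) * Complex.I) =
      Complex.exp (Complex.I * ((-(2 * Real.pi * s * u) : ℝ) : ℂ)) := by
    congr 1
    push_cast
    ring
  rw [hc]
  have hpi' : (Real.pi : ℂ) ≠ 0 := Complex.ofReal_ne_zero.2 Real.pi_ne_zero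
  push_cast
  field_simp

/-- The Fourier transform in the space variables of the slice of `f` at time `u`. -/
theorem IsTest.fourier_slice (hf : IsTest f) (u : ℝ) (ξ : E d) :
    fourier (fun x : E d => f (pair u x)) ξ =
      ∫ ζ : ℝ, Complex.exp (Complex.I * ((ζ * u : ℝ) : ℂ)) * fourier f (pair ζ ξ) := by
  have hpi : (0 : ℝ) < 2 * Real.pi := by positivity
  have hint : Integrable fun u => fourier (fun x : E d => f (pair u x)) ξ :=
    ((hf.integrable_exp_mul_pair ξ).integral_prod_left).const_mul _
  have hint' : Integrable (𝓕 fun u => fourier (fun x : E d => f (pair u x)) ξ) := by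
    rw [funext (hf.fourier_fourier_slice ξ)]
    exact ((hf.integrable_fourier_pair ξ).comp_mul_left' hpi.ne').const_mul _
  -- Inversion in the time variable alone; it holds at every `u` because the slice transform is
  -- continuous in `u`.
  have h := congrFun ((hf.continuous_fourier_slice ξ).fourierInv_fourier_eq hint hint') u
  rw [← h, Real.fourierInv_eq']
  have h2 := Measure.integral_comp_mul_left (fun ζ : ℝ =>
    Complex.exp (Complex.I * ((ζ * u : ℝ) : ℂ)) * fourier f (pair ζ ξ)) (2 * Real.pi)
  rw [abs_of_pos (inv_pos.2 hpi), eq_inv_smul_iff₀ hpi.ne', ← integral_smul] at h2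
  rw [← h2]
  refine integral_congr_ae (Eventually.of_forall fun s => ?_)
  simp only [hf.fourier_fourier_slice, smul_eq_mul, Complex.real_smul]
  have hc : Complex.exp (((2 * Real.pi * inner ℝ s u : ℝ) : ℂ) * Complex.I) =
      Complex.exp (Complex.I * ((2 * Real.pi * s * u : ℝ) : ℂ)) := by
    congr 1
    simp only [RCLike.inner_apply, conj_trivial]
    push_cast
    ring
  rw [hc]
  ring

end FourierSlice

/-! ### Lipschitz dependence on time and the space-time symbol -/

section SpaceTimeGenerator

variable {d : ℕ} {f : E (d + 1) → ℝ}

theorem IsTest.integrable_weight_mul_fourier_pair (hf : IsTest f) :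
    Integrable fun p : ℝ × E d => (1 + ‖p.2‖ ^ 2) * (|p.1| * ‖fourier f (pair p.1 p.2)‖) := by
  refine ((hf.integrable_pair 1).add (hf.integrable_pair 3)).mono' ?_
    (Eventually.of_forall fun p => ?_)
  · have := hf.continuous_fourier_pair
    exact Continuous.aestronglyMeasurable (by fun_prop)
  · rw [Real.norm_of_nonneg (by positivity), Pi.add_apply]
    have h1 := abs_le_norm_pair p.1 p.2
    have h2 := norm_le_norm_pair p.1 p.2
    have h3 : (1 + ‖p.2‖ ^ 2) * |p.1| ≤ (1 + ‖pair p.1 p.2‖ ^ 2) * ‖pair p.1 p.2‖ := by gcongr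
    calc (1 + ‖p.2‖ ^ 2) * (|p.1| * ‖fourier f (pair p.1 p.2)‖)
        = (1 + ‖p.2‖ ^ 2) * |p.1| * ‖fourier f (pair p.1 p.2)‖ := by ring
      _ ≤ (1 + ‖pair p.1 p.2‖ ^ 2) * ‖pair p.1 p.2‖ * ‖fourier f (pair p.1 p.2)‖ := by gcongr
      _ = _ := by ring

theorem norm_exp_I_mul_sub_le (a b : ℝ) :
    ‖Complex.exp (Complex.I * (a : ℂ)) - Complex.exp (Complex.I * (b : ℂ))‖ ≤ |a - b| := by
  have h : Complex.exp (Complex.I * (a : ℂ)) - Complex.exp (Complex.I * (b : ℂ)) =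
      Complex.exp (Complex.I * (b : ℂ)) * (Complex.exp (Complex.I * ((a - b : ℝ) : ℂ)) - 1) := by
    rw [mul_sub, ← Complex.exp_add, mul_one]
    congr 2
    push_cast
    ring
  rw [h, norm_mul, Complex.norm_exp_I_mul_ofReal, one_mul]
  exact Real.norm_exp_I_mul_ofReal_sub_one_le

theorem IsTest.norm_fourier_slice_sub_le (hf : IsTest f) (u v : ℝ) (ξ : E d) :
    ‖fourier (fun x : E d => f (pair u x)) ξ - fourier (fun x : E d => f (pair v x)) ξ‖ ≤
      |u - v| * ∫ ζ : ℝ, |ζ| * ‖fourier f (pair ζ ξ)‖ := by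
  have hexp : ∀ w : ℝ, Integrable fun ζ : ℝ =>
      Complex.exp (Complex.I * ((ζ * w : ℝ) : ℂ)) * fourier f (pair ζ ξ) := fun w =>
    integrable_exp_mul (hf.integrable_fourier_pair ξ)
      (by fun_prop : Continuous fun ζ : ℝ => ζ * w).aestronglyMeasurable
  rw [hf.fourier_slice, hf.fourier_slice, ← integral_sub (hexp u) (hexp v), ← integral_const_mul]
  have hint := (hf.integrable_abs_pow_mul_fourier_pair 1 ξ).const_mul |u - v|
  simp only [pow_one] at hint
  refine norm_integral_le_of_norm_le hint (Eventually.of_forall fun ζ => ?_)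
  rw [← sub_mul, norm_mul, ← mul_assoc]
  gcongr
  refine (norm_exp_I_mul_sub_le _ _).trans (le_of_eq ?_)
  rw [← mul_sub, abs_mul, mul_comm]

/-- The constant `B` depends on `f` alone. This lets the estimate be used with `φ =
q(x,·)e^{i⟨·,x⟩}` uniformly for `x` in a compact set. -/
theorem IsTest.exists_norm_integral_slice_sub_le (hf : IsTest f) :
    ∃ B : ℝ, 0 ≤ B ∧ ∀ (φ : E d → ℂ) (C : ℝ), 0 ≤ C → (∀ ξ, ‖φ ξ‖ ≤ C * (1 + ‖ξ‖ ^ 2)) →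
      ∀ u v : ℝ,
      Integrable (fun ξ => φ ξ * fourier (fun x : E d => f (pair u x)) ξ) →
      Integrable (fun ξ => φ ξ * fourier (fun x : E d => f (pair v x)) ξ) →
      ‖(∫ ξ, φ ξ * fourier (fun x : E d => f (pair u x)) ξ) -
        ∫ ξ, φ ξ * fourier (fun x : E d => f (pair v x)) ξ‖ ≤ C * B * |u - v| := by
  have hint : Integrable fun ξ : E d =>
      ∫ ζ : ℝ, (1 + ‖ξ‖ ^ 2) * (|ζ| * ‖fourier f (pair ζ ξ)‖) :=
    hf.integrable_weight_mul_fourier_pair.integral_prod_right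
  refine ⟨∫ ξ : E d, ∫ ζ : ℝ, (1 + ‖ξ‖ ^ 2) * (|ζ| * ‖fourier f (pair ζ ξ)‖),
    integral_nonneg fun ξ => integral_nonneg fun ζ => by positivity,
    fun φ C hC hφ u v hu hv => ?_⟩
  rw [← integral_sub hu hv]
  have h := norm_integral_le_of_norm_le (hint.const_mul (C * |u - v|))
    (f := fun ξ => φ ξ * fourier (fun x : E d => f (pair u x)) ξ -
      φ ξ * fourier (fun x : E d => f (pair v x)) ξ) (Eventually.of_forall fun ξ => ?_)
  · rw [integral_const_mul] at h
    linarith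
  · rw [← mul_sub, norm_mul, integral_const_mul]
    calc _ ≤ (C * (1 + ‖ξ‖ ^ 2)) * (|u - v| * ∫ ζ : ℝ, |ζ| * ‖fourier f (pair ζ ξ)‖) :=
          mul_le_mul (hφ ξ) (hf.norm_fourier_slice_sub_le u v ξ) (norm_nonneg _) (by positivity)
      _ = _ := by ring

/-- Lipschitz continuity of `f`, localised by a cutoff that does not depend on `u, v`: the form the
maximum principle requires. -/
theorem IsTest.exists_abs_slice_sub_le (hf : IsTest f) :
    ∃ (c : ℝ) (χ : E d → ℝ), 0 ≤ c ∧ IsTest χ ∧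
      ∀ u v x, |f (pair u x) - f (pair v x)| ≤ c * |u - v| * χ x := by
  obtain ⟨R, hR0, hR⟩ := hf.exists_radius
  obtain ⟨χ, hχ, hχ0, -, hχ1, -⟩ := exists_isTest_cutoff d hR0
  obtain ⟨c, hc⟩ := ContDiff.lipschitzWith_of_hasCompactSupport hf.2 hf.1 (by simp)
  refine ⟨c, χ, c.2, hχ, fun u v x => ?_⟩
  rcases le_total ‖x‖ R with hx | hx
  · have h := hc.dist_le_mul (pair u x) (pair v x)
    rwa [dist_pair_left, Real.dist_eq, ← mul_one (c * |u - v|), ← hχ1 x hx] at h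
  · rw [hR _ (hx.trans (norm_le_norm_pair u x)), hR _ (hx.trans (norm_le_norm_pair v x)), sub_self,
      abs_zero]
    exact mul_nonneg (by positivity) (hχ0 x)

namespace IsLevyTypeProcess

variable {Ω : Type*} [mΩ : MeasurableSpace Ω] {F : ProcessData d Ω} {q : E d → E d → ℂ}
  (hF : IsLevyTypeProcess F q)

include hF

/-- The generator acts Lipschitz continuously on the slices of a test function. -/
theorem exists_lipschitz_generator_slice (hf : IsTest f) {g : ℝ → E d → ℝ}
    (hg : ∀ u, IsGeneratorPair F (fun x => f (pair u x)) (g u))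
    (hint : ∀ u x, Integrable fun ξ : E d => q x ξ * Complex.exp (Complex.I * (inner ℝ ξ x : ℝ)) *
      fourier (fun x : E d => f (pair u x)) ξ)
    (hgq : ∀ u x, (g u x : ℂ) = -∫ ξ : E d, q x ξ *
      Complex.exp (Complex.I * (inner ℝ ξ x : ℝ)) * fourier (fun x : E d => f (pair u x)) ξ) :
    ∃ L : ℝ, 0 ≤ L ∧ ∀ u v x, |g u x - g v x| ≤ L * |u - v| := by
  obtain ⟨c, χ, hc, hχ, hfχ⟩ := hf.exists_abs_slice_sub_le
  obtain ⟨h, hχh, -⟩ := hF.generator χ hχ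
  obtain ⟨D, hD0, hD⟩ := hχh.2.right.exists_nonneg_bound
  obtain ⟨R, -, hR⟩ := hχ.exists_radius
  obtain ⟨C, hC0, hC⟩ := hF.symbol.exists_norm_le (isCompact_closedBall (0 : E d) R)
  obtain ⟨B, hB0, hB⟩ := hf.exists_norm_integral_slice_sub_le
  refine ⟨C * B + c * D, by positivity, fun u v x => ?_⟩
  -- Inside the ball carrying `χ` the symbol is controlled uniformly in `x` and the Fourier formula
  -- applies. Outside, `χ x = 0`, and the maximum principle bounds the difference by `c|u - v|`
  -- times the generator of `χ`.
  rcases le_total ‖x‖ R with hx | hx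
  · have h1 := hB (fun ξ => q x ξ * Complex.exp (Complex.I * (inner ℝ ξ x : ℝ))) C hC0
      (fun ξ => by
        rw [norm_mul, Complex.norm_exp_I_mul_ofReal, mul_one]
        exact hC x (by simpa using hx) ξ) v u (hint v x) (hint u x)
    have h2 : |g u x - g v x| = ‖(g u x : ℂ) - (g v x : ℂ)‖ := by
      rw [← Complex.ofReal_sub, Complex.norm_real, Real.norm_eq_abs]
    rw [h2, hgq, hgq, neg_sub_neg]
    refine h1.trans ?_
    rw [abs_sub_comm v u]
    nlinarith [mul_nonneg (mul_nonneg hc hD0) (abs_nonneg (u - v))]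
  · have h1 := ((hg u).sub hF.isFeller.isMarkov (hg v)).abs_le_of_abs_le_mul
      hF.isFeller.isMarkov hχh.2 (hfχ u v) (hR x hx)
    have h2 : c * |u - v| * h x ≤ c * |u - v| * D :=
      mul_le_mul_of_nonneg_left ((le_abs_self _).trans (hD x)) (by positivity)
    nlinarith [mul_nonneg (mul_nonneg hC0 hB0) (abs_nonneg (u - v))]

theorem integrable_spaceTime_symbol (hf : IsTest f) (z : E (d + 1)) :
    Integrable fun w : E (d + 1) => q (spacePart z) (spacePart w) *
      (Complex.exp (Complex.I * (inner ℝ w z : ℝ)) * fourier f w) := by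
  obtain ⟨C, hC0, hC⟩ := hF.symbol.exists_norm_le (isCompact_singleton (x := spacePart z))
  have h0 := hf.integrable_pow_mul_fourier 0
  have h2 := hf.integrable_pow_mul_fourier 2
  have hc := hf.continuous_fourier
  have hq : Continuous fun w => q (spacePart z) (spacePart w) :=
    (hF.symbol.continuous (spacePart z)).comp continuous_spacePart
  refine ((h0.add h2).const_mul C).mono'
    (hq.mul ((by fun_prop : Continuous fun w : E (d + 1) =>
      Complex.exp (Complex.I * (inner ℝ w z : ℝ))).mul hc)).aestronglyMeasurable
    (Eventually.of_forall fun w => ?_)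
  rw [norm_mul, norm_mul, Complex.norm_exp_I_mul_ofReal, one_mul, Pi.add_apply, pow_zero,
    ← add_mul, ← mul_assoc]
  gcongr
  refine (hC _ rfl (spacePart w)).trans ?_
  have : ‖spacePart w‖ ≤ ‖w‖ := by
    simpa [pair_timePart_spacePart] using norm_le_norm_pair (timePart w) (spacePart w)
  gcongr

/-- The symbol of `F` does not involve `ζ`, so integrating over `ζ` first reconstructs the spatial
transform of the slice at the time of `z`. -/
theorem integral_spaceTime_symbol (hf : IsTest f) (z : E (d + 1)) :
    ∫ w : E (d + 1), q (spacePart z) (spacePart w) *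
      (Complex.exp (Complex.I * (inner ℝ w z : ℝ)) * fourier f w) =
    ∫ ξ : E d, q (spacePart z) ξ * Complex.exp (Complex.I * (inner ℝ ξ (spacePart z) : ℝ)) *
      fourier (fun x : E d => f (pair (timePart z) x)) ξ := by
  have hint := (measurePreserving_pair.integrable_comp_emb measurableEmbedding_pair).2
    (hF.integrable_spaceTime_symbol hf z)
  simp only [Function.comp_def] at hint
  rw [← measurePreserving_pair.integral_comp measurableEmbedding_pair, Measure.volume_eq_prod,
    integral_prod_symm _ hint]
  refine integral_congr_ae (Eventually.of_forall fun ξ => ?_)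
  simp only [spacePart_pair]
  rw [hf.fourier_slice, ← integral_const_mul]
  refine integral_congr_ae (Eventually.of_forall fun ζ => ?_)
  simp only
  have hz : inner ℝ (pair ζ ξ) z = ζ * timePart z + inner ℝ ξ (spacePart z) := by
    rw [← inner_pair, pair_timePart_spacePart]
  rw [hz, Complex.ofReal_add, mul_add, Complex.exp_add]
  ring

/-- The space-time process of a Lévy-type process is a Lévy-type process. -/
theorem spaceTime : IsLevyTypeProcess (LevyType.spaceTime F) fun z w : E (d + 1) =>
    -Complex.I * (timePart w : ℂ) + q (spacePart z) (spacePart w) := by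
  refine ⟨hF.isFeller.spaceTime, hF.symbol.spaceTime, fun f hf => ?_⟩
  choose g hg hgx using fun u : ℝ => hF.generator _ (hf.slice u)
  have hint := fun u x => (hgx u x).1
  have hgq := fun u x => (hgx u x).2
  obtain ⟨L, hL0, hL⟩ := hF.exists_lipschitz_generator_slice hf (fun u => (hg u).2) hint hgq
  obtain ⟨R, -, hR⟩ := hf.exists_radius
  have hf' := hf.fderiv_apply (pair 1 (0 : E d))
  have hm : ∀ w : E (d + 1), inner ℝ w (pair 1 (0 : E d)) = timePart w := fun w => by
    conv_lhs => rw [← pair_timePart_spacePart w]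
    rw [inner_pair, inner_zero_right, mul_one, add_zero]
  -- Multiplication by `iζ` is differentiation in time on the Fourier side, so inversion of this
  -- part returns `∂_u f`.
  have htime : ∀ z w : E (d + 1), -Complex.I * (timePart w : ℂ) *
      (Complex.exp (Complex.I * (inner ℝ w z : ℝ)) * fourier f w) =
      -(Complex.exp (Complex.I * (inner ℝ w z : ℝ)) *
        fourier (fun z => fderiv ℝ f z (pair 1 0)) w) := fun z w => by
    rw [hf.fourier_fderiv_apply, hm]
    ring
  refine ⟨fun z => fderiv ℝ f z (pair 1 0) + g (timePart z) (spacePart z),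
    ⟨hf.isVanishing, hF.isFeller.isGeneratorPair_spaceTime hf.isVanishing hf'.isVanishing
      hf.hasDerivAt_slice (fun u x hu => hR _ (hu.trans (abs_le_norm_pair u x)))
      (fun u => (hg u).2) hL0 hL⟩, fun z => ?_⟩
  have hint1 : Integrable fun w : E (d + 1) => -Complex.I * (timePart w : ℂ) *
      (Complex.exp (Complex.I * (inner ℝ w z : ℝ)) * fourier f w) := by
    simp only [htime]
    have h0 : Integrable (fourier fun z => fderiv ℝ f z (pair 1 (0 : E d))) :=
      (hf'.integrable_pow_mul_fourier 0).mono' hf'.continuous_fourier.aestronglyMeasurable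
        (Eventually.of_forall fun w => by simp)
    exact (integrable_exp_mul (φ := fun w => inner ℝ w z) h0
      (by fun_prop : Continuous fun w : E (d + 1) => inner ℝ w z).aestronglyMeasurable).neg
  have hint2 := hF.integrable_spaceTime_symbol hf z
  have hsplit : ∀ w : E (d + 1), (-Complex.I * (timePart w : ℂ) +
      q (spacePart z) (spacePart w)) * Complex.exp (Complex.I * (inner ℝ w z : ℝ)) * fourier f w =
      -Complex.I * (timePart w : ℂ) *
        (Complex.exp (Complex.I * (inner ℝ w z : ℝ)) * fourier f w) +
      q (spacePart z) (spacePart w) *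
        (Complex.exp (Complex.I * (inner ℝ w z : ℝ)) * fourier f w) := fun w => by ring
  simp only [hsplit]
  refine ⟨hint1.add hint2, ?_⟩
  rw [integral_add hint1 hint2, hF.integral_spaceTime_symbol hf z, Complex.ofReal_add, hgq]
  simp only [htime]
  rw [integral_neg, hf'.integral_exp_mul_fourier]
  ring

end IsLevyTypeProcess

end SpaceTimeGenerator

end LevyType

end

theorem mainTheorem6 {d : ℕ} {Ω : Type*} [MeasurableSpace Ω]
    (F : LevyType.ProcessData d Ω) (qF : LevyType.E d → LevyType.E d → ℂ)
    (hF : LevyType.IsLevyTypeProcess F qF)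
    (qM : LevyType.E (d + 1) → LevyType.E (d + 1) → ℂ)
    (hqM : ∀ (u : ℝ) (x : LevyType.E d) (ζ : ℝ) (ξ : LevyType.E d),
      qM (LevyType.pair u x) (LevyType.pair ζ ξ) = -Complex.I * (ζ : ℂ) + qF x ξ) :
    LevyType.IsLevyTypeProcess (LevyType.spaceTime F) qM ∧
      (LevyType.IsCadlag F → LevyType.IsCadlag (LevyType.spaceTime F)) := by
  -- Every point of `ℝ^(d+1)` is a pair, so the hypothesis determines `qM` everywhere.
  have h : qM = fun z w => -Complex.I * (LevyType.timePart w : ℂ) +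
      qF (LevyType.spacePart z) (LevyType.spacePart w) := by
    funext z w
    rw [← hqM (LevyType.timePart z), LevyType.pair_timePart_spacePart,
      LevyType.pair_timePart_spacePart]
  exact ⟨h ▸ hF.spaceTime, LevyType.IsCadlag.spaceTime⟩
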